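/- Let $P$ be a simple orthogonal polygon without holes, with $n$ vertices at integer lattice points (every edge is horizontal or vertical and consecutive edges are perpendicular). A block is a unit lattice square $[x,x+1]\times[y,y+1]$ inside $P$. All squares and rectangles are axis-parallel with lattice corners. A valid square is a square contained in $P$; it is maximal if no larger valid square contains it. A rec-pack of width $t>0$ and strength $\eta\ge 1$ ($\eta\in\mathbb N$) is a $t\times\eta t$ or $\eta t\times t$ rectangle contained in $P$; it stands for the $\eta$ squares of side $t$ that tile it. A set of rec-packs covers $P$ if these squares cover $P$. For a set $\mathscr R$ of rec-packs let $G^{\mathscr R}(P)$ be the graph on the blocks of $P$ not covered by $\mathscr R$, two distinct blocks being adjacent if some valid square covers both. A maximal square $S$ is unambiguous given $\mathscr R$ if it covers some simplicial node $p$ of $G^{\mathscr R}(P)$ (a node whose closed neighbourhood is a clique) and all neighbours of $p$ in $G^{\mathscr R}(P)$. A strip is an inclusion-maximal non-square rectangle $Y\subseteq P$ each of whose two longer sides is contained in an edge of $P$; these two edges are said to bound $Y$. Given $\mathscr R$ and a maximal square $S\in\mathscr R$ of side $d$ (the seed), the rec-pack generated by $S$ to the right is defined as follows. Suppose that the top right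 and the bottom right corner of $S$ lie on edges $e_1$ and $e_2$ of $P$ such that there is a strip $Y$ bounded by $e_1,e_2$ whose right side is more than $d$ to the right of the right side of $S$. Then it is the rec-pack $R\subseteq Y$ of width $d$ and largest possible strength $\eta\ge1$ whose left side coincides with the right side of $S$ and which overlaps (in positive area) no member of $\mathscr R$. If there are no such edges or no such $R$, nothing is generated. The other three directions are symmetric. Consider the following algorithm. Start with $\mathscr R=\emptyset$. While $\mathscr R$ does not cover $P$: let $C_x$ be the set of points $(x,y)$ such that $x$ is the $x$-coordinate of a vertex of $P$ and $y$ is the $y$-coordinate of a vertex of $P$ or of a corner of a member of $\mathscr R$, and define $C_y$ in the same way with the roles of the coordinates exchanged; choose a square $S$ that has a corner in $C_x\cup C_y$ and is unambiguous given $\mathscr R$ (the first one found, in any order of examination); add $S$ to $\mathscr R$; then add the (at most four) rec-packs generated, with respect to this $\mathscr R$, by the seed $S$ to the left, to the right, to the top and to the bottom. If $\mathscr R$ is the final set of rec-packs of this algorithm, then $|\mathscr R|=O(n^2)$; that is, there is an absolute constant $C$ such that $|\mathscr R|\le C n^2$ for every $n$, every such polygon $P$ with $n$ vertices and every run of the algorithm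 on $P$, where $\mathscr R$ is the set at the end of the run. -/

import Mathlib

namespace OPCS

/-! ## Orthogonal polygons with integral vertices -/

/-- A simple orthogonal polygon (without holes) with `n` vertices at lattice points, listed in
cyclic order. Edge `i` joins vertex `i` to vertex `i + 1`, indices being taken modulo `n`. -/
structure OrthoPolygon (n : ℕ) [NeZero n] where
  /-- the vertices in cyclic order -/
  vert : Fin n → ℤ × ℤ
  /-- every edge is a nondegenerate vertical or horizontal segment -/
  axis : ∀ i, ((vert i).1 = (vert (i + 1)).1 ∧ (vert i).2 ≠ (vert (i + 1)).2) ∨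
    ((vert i).2 = (vert (i + 1)).2 ∧ (vert i).1 ≠ (vert (i + 1)).1)
  /-- consecutive edges are perpendicular: the angle at each vertex is 90 or 270 degrees -/
  turn : ∀ i, (vert i).1 = (vert (i + 1)).1 ↔ (vert (i + 1)).2 = (vert (i + 1 + 1)).2
  /-- edges that are not consecutive do not meet; two axis-parallel segments with lattice
  endpoints meet if and only if they have a lattice point in common -/
  simple : ∀ i j, i ≠ j → i + 1 ≠ j → j + 1 ≠ i →
    Disjoint (Set.uIcc (vert i) (vert (i + 1))) (Set.uIcc (vert j) (vert (j + 1)))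

/-- An axis-parallel rectangle `[left, right] × [bottom, top]` with lattice corners. -/
@[ext]
structure Rect where
  left : ℤ
  right : ℤ
  bottom : ℤ
  top : ℤ

namespace Rect

def width (R : Rect) : ℤ := R.right - R.left

def height (R : Rect) : ℤ := R.top - R.bottom

/-- The blocks contained in `R`. The block `[x, x + 1] × [y, y + 1]` is represented by its lower
left corner `(x, y)`. -/
def blocks (R : Rect) : Set (ℤ × ℤ) :=
  {b | R.left ≤ b.1 ∧ b.1 < R.right ∧ R.bottom ≤ b.2 ∧ b.2 < R.top}

def corners (R : Rect) : Set (ℤ × ℤ) :=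
  {(R.left, R.bottom), (R.left, R.top), (R.right, R.bottom), (R.right, R.top)}

/-- The lattice points of the four sides. -/
def topSide (R : Rect) : Set (ℤ × ℤ) := Set.Icc (R.left, R.top) (R.right, R.top)

def bottomSide (R : Rect) : Set (ℤ × ℤ) := Set.Icc (R.left, R.bottom) (R.right, R.bottom)

def leftSide (R : Rect) : Set (ℤ × ℤ) := Set.Icc (R.left, R.bottom) (R.left, R.top)

def rightSide (R : Rect) : Set (ℤ × ℤ) := Set.Icc (R.right, R.bottom) (R.right, R.top)

/-- Two rectangles overlap if their intersection has positive area. -/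
def Overlaps (R T : Rect) : Prop := (R.blocks ∩ T.blocks).Nonempty

end Rect

namespace OrthoPolygon

variable {n : ℕ} [NeZero n]

/-- The lattice points of edge `i`. -/
def edge (P : OrthoPolygon n) (i : Fin n) : Set (ℤ × ℤ) :=
  Set.uIcc (P.vert i) (P.vert (i + 1))

/-- The vertical edges met by the horizontal ray that starts at the centre of the block `b` and
runs to the right. -/
def rayCrossings (P : OrthoPolygon n) (b : ℤ × ℤ) : Finset (Fin n) :=
  {i | (P.vert i).1 = (P.vert (i + 1)).1 ∧ b.1 < (P.vert i).1 ∧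
    min (P.vert i).2 (P.vert (i + 1)).2 ≤ b.2 ∧ b.2 < max (P.vert i).2 (P.vert (i + 1)).2}

/-- The blocks inside `P` (even-odd rule for the interior of a simple polygon). -/
def region (P : OrthoPolygon n) : Set (ℤ × ℤ) := {b | Odd (P.rayCrossings b).card}

/-- `R` is a (nondegenerate) rectangle contained in `P`. -/
def Inside (P : OrthoPolygon n) (R : Rect) : Prop :=
  0 < R.width ∧ 0 < R.height ∧ R.blocks ⊆ P.region

/-- Valid squares: axis-parallel squares contained in `P`. -/
def IsValidSquare (P : OrthoPolygon n) (S : Rect) : Prop :=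
  P.Inside S ∧ S.width = S.height

/-- Maximal squares: valid squares that lie in no valid square of larger area. -/
def IsMaximalSquare (P : OrthoPolygon n) (S : Rect) : Prop :=
  P.IsValidSquare S ∧
    ∀ T, P.IsValidSquare T → S.blocks ⊆ T.blocks → ¬ S.width < T.width

/-- `R` is a rec-pack of `P` of width `t` and strength `η`: a rectangle of dimension `t × ηt` or
`ηt × t` contained in `P`. -/
def IsRecPack (P : OrthoPolygon n) (t : ℤ) (η : ℕ) (R : Rect) : Prop :=
  1 ≤ η ∧ P.Inside R ∧
    ((R.width = t ∧ R.height = η * t) ∨ (R.width = η * t ∧ R.height = t))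

/-- The set `𝓡` of rec-packs covers `P`. (The squares extracted from a rec-pack tile it, so they
cover the same blocks as the rec-pack.) -/
def Covers (P : OrthoPolygon n) (𝓡 : Set Rect) : Prop :=
  ∀ b ∈ P.region, ∃ R ∈ 𝓡, b ∈ R.blocks

/-! ## The associated graph and unambiguous squares -/

/-- The associated graph `G(P)`: its nodes are the blocks inside `P`, and two of them are
adjacent if some valid square covers both. -/
def assocGraph (P : OrthoPolygon n) : SimpleGraph P.region where
  Adj b c := b ≠ c ∧ ∃ S, P.IsValidSquare S ∧ (b : ℤ × ℤ) ∈ S.blocks ∧ (c : ℤ × ℤ) ∈ S.blocks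
  symm := ⟨fun _ _ h => ⟨h.1.symm, h.2.imp fun _ hS => ⟨hS.1, hS.2.2, hS.2.1⟩⟩⟩
  loopless := ⟨fun _ h => h.1 rfl⟩

/-- The blocks inside `P` that are not covered by `𝓡`. -/
def uncovered (P : OrthoPolygon n) (𝓡 : Set Rect) : Set P.region :=
  {b | ∀ R ∈ 𝓡, (b : ℤ × ℤ) ∉ R.blocks}

/-- The subgraph of `G(P)` induced by the blocks that `𝓡` does not cover. -/
def residualGraph (P : OrthoPolygon n) (𝓡 : Set Rect) : SimpleGraph (P.uncovered 𝓡) :=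
  P.assocGraph.induce (P.uncovered 𝓡)

end OrthoPolygon

/-- A node is simplicial if its closed neighbourhood is a clique. -/
def IsSimplicial {V : Type*} (G : SimpleGraph V) (v : V) : Prop :=
  G.IsClique (insert v (G.neighborSet v))

namespace OrthoPolygon

variable {n : ℕ} [NeZero n]

/-- `S` is an unambiguous square given `𝓡`: a maximal square that covers a simplicial node of the
residual graph together with all its neighbours there. -/
def IsUnambiguous (P : OrthoPolygon n) (𝓡 : Set Rect) (S : Rect) : Prop :=
  P.IsMaximalSquare S ∧
    ∃ p : P.uncovered 𝓡, IsSimplicial (P.residualGraph 𝓡) p ∧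
      (p : ℤ × ℤ) ∈ S.blocks ∧
      ∀ q : P.uncovered 𝓡, (P.residualGraph 𝓡).Adj p q → (q : ℤ × ℤ) ∈ S.blocks

/-! ## Strips and the rec-packs generated by a seed -/

/-- `Y` is a non-square rectangle in `P` whose two longer sides lie in the edges `e₁`
(top or left side) and `e₂` (bottom or right side). -/
def IsStripRegion (P : OrthoPolygon n) (e₁ e₂ : Fin n) (Y : Rect) : Prop :=
  P.Inside Y ∧
    ((Y.height < Y.width ∧ Y.topSide ⊆ P.edge e₁ ∧ Y.bottomSide ⊆ P.edge e₂) ∨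
      (Y.width < Y.height ∧ Y.leftSide ⊆ P.edge e₁ ∧ Y.rightSide ⊆ P.edge e₂))

/-- `Y` is a strip of `P` between the edges `e₁` and `e₂`. -/
def IsStrip (P : OrthoPolygon n) (e₁ e₂ : Fin n) (Y : Rect) : Prop :=
  P.IsStripRegion e₁ e₂ Y ∧
    ∀ f₁ f₂ Y', P.IsStripRegion f₁ f₂ Y' → Y.blocks ⊆ Y'.blocks → Y' = Y

end OrthoPolygon

/-- The four directions in which a seed can generate a rec-pack. -/
inductive Dir
  | left
  | right
  | up
  | down

/-- The two corners of `S` on the side facing direction `δ` (the top one, or the left one,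
first). -/
def Rect.frontCorners (S : Rect) : Dir → (ℤ × ℤ) × (ℤ × ℤ)
  | .left => ((S.left, S.top), (S.left, S.bottom))
  | .right => ((S.right, S.top), (S.right, S.bottom))
  | .up => ((S.left, S.top), (S.right, S.top))
  | .down => ((S.left, S.bottom), (S.right, S.bottom))

/-- How far, in direction `δ`, the end of `Y` lies beyond the side of `S` facing `δ`. -/
def Rect.reach (S Y : Rect) : Dir → ℤ
  | .left => S.left - Y.left
  | .right => Y.right - S.right
  | .up => Y.top - S.top
  | .down => S.bottom - Y.bottom

/-- The side of `S` facing direction `δ` coincides with the opposite side of `R`. -/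
def Rect.Abuts (S R : Rect) : Dir → Prop
  | .left => R.right = S.left ∧ R.bottom = S.bottom ∧ R.top = S.top
  | .right => R.left = S.right ∧ R.bottom = S.bottom ∧ R.top = S.top
  | .up => R.bottom = S.top ∧ R.left = S.left ∧ R.right = S.right
  | .down => R.top = S.bottom ∧ R.left = S.left ∧ R.right = S.right

namespace OrthoPolygon

variable {n : ℕ} [NeZero n]

/-- `R` is a rec-pack of strength `η` that may be placed next to the seed `S` in direction `δ`:
the two corners of `S` on its side facing `δ` lie on edges `e₁`, `e₂`, there is a strip `Y`
between these edges whose end in direction `δ` is more than the side length of `S` away from `S`,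
and `R` has the width of `S`, starts at `S`, lies in `Y`, and overlaps no member of `𝓡`. -/
def CanPlace (P : OrthoPolygon n) (𝓡 : Set Rect) (S : Rect) (δ : Dir) (η : ℕ) (R : Rect) :
    Prop :=
  ∃ e₁ e₂ Y, (S.frontCorners δ).1 ∈ P.edge e₁ ∧ (S.frontCorners δ).2 ∈ P.edge e₂ ∧
    P.IsStrip e₁ e₂ Y ∧ S.width < S.reach Y δ ∧
    P.IsRecPack S.width η R ∧ S.Abuts R δ ∧ R.blocks ⊆ Y.blocks ∧
    ∀ T ∈ 𝓡, ¬ R.Overlaps T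

/-- The rec-pack generated with seed `S` in direction `δ`, given `𝓡`: the one of largest strength
among those that can be placed. The set is empty (the answer is NONE) if there is none. -/
def generated (P : OrthoPolygon n) (𝓡 : Set Rect) (S : Rect) (δ : Dir) : Set Rect :=
  {R | ∃ η, P.CanPlace 𝓡 S δ η R ∧ ∀ η' R', P.CanPlace 𝓡 S δ η' R' → η' ≤ η}

/-! ## The algorithm -/

def IsVertexX (P : OrthoPolygon n) (x : ℤ) : Prop := ∃ i, (P.vert i).1 = x

def IsVertexY (P : OrthoPolygon n) (y : ℤ) : Prop := ∃ i, (P.vert i).2 = y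

def Cx (P : OrthoPolygon n) (𝓡 : Set Rect) : Set (ℤ × ℤ) :=
  {c | P.IsVertexX c.1 ∧ (P.IsVertexY c.2 ∨ ∃ R ∈ 𝓡, ∃ a ∈ R.corners, a.2 = c.2)}

def Cy (P : OrthoPolygon n) (𝓡 : Set Rect) : Set (ℤ × ℤ) :=
  {c | (P.IsVertexX c.1 ∨ ∃ R ∈ 𝓡, ∃ a ∈ R.corners, a.1 = c.1) ∧ P.IsVertexY c.2}

/-- The squares examined in the current iteration. -/
def IsCandidate (P : OrthoPolygon n) (𝓡 : Set Rect) (S : Rect) : Prop :=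
  P.IsValidSquare S ∧ (S.corners ∩ (P.Cx 𝓡 ∪ P.Cy 𝓡)).Nonempty

/-- One iteration of the while loop. As long as `𝓡` does not cover `P`, an unambiguous candidate
square `S` is added, together with the rec-packs generated with seed `S` in the four directions.
The order in which candidates are examined is not prescribed, so any unambiguous candidate may be
the one that is found. -/
def Step (P : OrthoPolygon n) (𝓡 𝓡' : Finset Rect) : Prop :=
  ¬ P.Covers 𝓡 ∧ ∃ S, P.IsCandidate 𝓡 S ∧ P.IsUnambiguous 𝓡 S ∧
    (𝓡' : Set Rect) = insert S (𝓡 : Set Rect) ∪ ⋃ δ, P.generated (insert S (𝓡 : Set Rect)) S δ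

/-- `𝓡` is the set of rec-packs at the end of a run of the algorithm: it is reached from the
empty set by iterations of the loop, and it covers `P`. -/
def IsFinal (P : OrthoPolygon n) (𝓡 : Finset Rect) : Prop :=
  Relation.ReflTransGen P.Step ∅ 𝓡 ∧ P.Covers 𝓡

end OrthoPolygon

end OPCS

namespace OPCS

/-! Every seed `S` is chosen for an uncovered block `p`, its witness. Once `S` is added, every block
that shares a valid square with `p` is covered: it was covered before, or it is `p` or a neighbour
of `p` in the residual graph and so lies in `S`. A later witness is uncovered when chosen, so no
valid square covers two witnesses (`IsIndependentFamily`). Each iteration adds at most one seed and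
four rec-packs, so it suffices to bound the number of seeds by a multiple of `n ^ 2`.

A maximal square is one of three kinds. Either its top and bottom both meet the boundary
(`HBlocked`), or its left and right do, or two adjacent sides are free; in the last case their
common corner is a vertex, since otherwise the square could grow diagonally
(`exists_corner_of_maximal`). Squares with the same corner are nested, hence equal by independence,
which gives at most `4 * V.card` of the last kind.

Among the squares blocked above and below, those with a vertex on the top or bottom side are
determined by that vertex, a vertex at the height of the opposite side, and the side of the first
vertex on which the witness lies. The others are sections of a strip that reach from one long side
to the other. The number of maximal strips is linear in the number of vertices, and each has four
end zones as long as the strip is high. Two blocks of one zone lie in a common valid square, so a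
zone holds at most one witness.

Only the middle of a strip needs the rec-packs. When the first seed of full height touches the
strip, earlier members of `𝓡` overlap the strip only near its ends: a maximal square further inside
that is lower than the strip could be enlarged (`hClear_of_not_hTouch`). Hence nothing stops the
generated packs before they have covered the middle (`exists_mem_of_hMid`), and later witnesses
avoid it. This is what `RunInvariant` carries through the run. The count is `14 + 14 + 4 = 32` times
`n ^ 2` seeds, and `5 * 32 = 160`. -/

/-! ### Edges and the even-odd rule -/

lemma odd_card_iff_exists {n : ℕ} {q : Fin n → Prop} [DecidablePred q]
    (h : Set.Subsingleton {i | q i}) :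
    Odd (Finset.card {i | q i}) ↔ ∃ i, q i := by
  have h1 : (Finset.card {i | q i}) ≤ 1 := by
    rw [Finset.card_le_one]
    intro a ha b hb
    exact h (by simpa using ha) (by simpa using hb)
  constructor
  · intro ho
    obtain ⟨i, hi⟩ := Finset.card_pos.1 ho.pos
    exact ⟨i, by simpa using hi⟩
  · rintro ⟨i, hi⟩
    have : 0 < (Finset.card {i | q i}) := Finset.card_pos.2 ⟨i, by simpa using hi⟩
    rw [show (Finset.card {i | q i}) = 1 by omega]
    exact odd_one

namespace OrthoPolygon

variable {n : ℕ} [NeZero n] (P : OrthoPolygon n)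

/-- Edge `i` is horizontal and contains the unit segment from `(x, y)` to `(x + 1, y)`. -/
def HCovers (i : Fin n) (x y : ℤ) : Prop :=
  (P.vert i).2 = (P.vert (i + 1)).2 ∧ (P.vert i).2 = y ∧
    min (P.vert i).1 (P.vert (i + 1)).1 ≤ x ∧ x < max (P.vert i).1 (P.vert (i + 1)).1

/-- Edge `i` is vertical and contains the unit segment from `(x, y)` to `(x, y + 1)`. -/
def VCovers (i : Fin n) (x y : ℤ) : Prop :=
  (P.vert i).1 = (P.vert (i + 1)).1 ∧ (P.vert i).1 = x ∧
    min (P.vert i).2 (P.vert (i + 1)).2 ≤ y ∧ y < max (P.vert i).2 (P.vert (i + 1)).2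

lemma mem_edge {i : Fin n} {c : ℤ × ℤ} : c ∈ P.edge i ↔
    (min (P.vert i).1 (P.vert (i + 1)).1 ≤ c.1 ∧ c.1 ≤ max (P.vert i).1 (P.vert (i + 1)).1) ∧
    (min (P.vert i).2 (P.vert (i + 1)).2 ≤ c.2 ∧ c.2 ≤ max (P.vert i).2 (P.vert (i + 1)).2) := by
  simp only [edge, Set.uIcc, Set.mem_Icc, Prod.le_def, Prod.fst_inf, Prod.snd_inf, Prod.fst_sup,
    Prod.snd_sup]
  tauto

lemma consecutive_of_mem {i j : Fin n} {c : ℤ × ℤ} (hi : c ∈ P.edge i) (hj : c ∈ P.edge j) :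
    i = j ∨ i + 1 = j ∨ j + 1 = i := by
  by_contra! h
  exact Set.disjoint_left.1 (P.simple i j h.1 h.2.1 h.2.2) hi hj

/-- Edges that meet are equal or consecutive, and consecutive edges are perpendicular. -/
lemma horizontal_edge_unique {i j : Fin n} {c : ℤ × ℤ}
    (hi : (P.vert i).2 = (P.vert (i + 1)).2) (hj : (P.vert j).2 = (P.vert (j + 1)).2)
    (hci : c ∈ P.edge i) (hcj : c ∈ P.edge j) : i = j := by
  have key : ∀ k : Fin n, (P.vert k).2 = (P.vert (k + 1)).2 →
      (P.vert (k + 1)).2 = (P.vert (k + 1 + 1)).2 → False := by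
    intro k h₁ h₂
    have := (P.turn k).2 h₂
    rcases P.axis k with h | h <;> tauto
  rcases P.consecutive_of_mem hci hcj with h | rfl | rfl
  · exact h
  · exact (key _ hi hj).elim
  · exact (key _ hj hi).elim

lemma vertical_edge_unique {i j : Fin n} {c : ℤ × ℤ}
    (hi : (P.vert i).1 = (P.vert (i + 1)).1) (hj : (P.vert j).1 = (P.vert (j + 1)).1)
    (hci : c ∈ P.edge i) (hcj : c ∈ P.edge j) : i = j := by
  have key : ∀ k : Fin n, (P.vert k).1 = (P.vert (k + 1)).1 →
      (P.vert (k + 1)).1 = (P.vert (k + 1 + 1)).1 → False := by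
    intro k h₁ h₂
    have := (P.turn k).1 h₁
    rcases P.axis (k + 1) with h | h <;> tauto
  rcases P.consecutive_of_mem hci hcj with h | rfl | rfl
  · exact h
  · exact (key _ hi hj).elim
  · exact (key _ hj hi).elim

variable {P}

lemma HCovers.left_mem {i : Fin n} {x y : ℤ} (h : P.HCovers i x y) : (x, y) ∈ P.edge i := by
  obtain ⟨h₁, h₂, h₃, h₄⟩ := h
  rw [mem_edge]
  dsimp only
  omega

lemma HCovers.right_mem {i : Fin n} {x y : ℤ} (h : P.HCovers i x y) : (x + 1, y) ∈ P.edge i := by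
  obtain ⟨h₁, h₂, h₃, h₄⟩ := h
  rw [mem_edge]
  dsimp only
  omega

lemma VCovers.bottom_mem {i : Fin n} {x y : ℤ} (h : P.VCovers i x y) : (x, y) ∈ P.edge i := by
  obtain ⟨h₁, h₂, h₃, h₄⟩ := h
  rw [mem_edge]
  dsimp only
  omega

lemma VCovers.top_mem {i : Fin n} {x y : ℤ} (h : P.VCovers i x y) : (x, y + 1) ∈ P.edge i := by
  obtain ⟨h₁, h₂, h₃, h₄⟩ := h
  rw [mem_edge]
  dsimp only
  omega

variable (P)

lemma subsingleton_hCovers (x y : ℤ) : Set.Subsingleton {i | P.HCovers i x y} :=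
  fun _ hi _ hj => P.horizontal_edge_unique hi.1 hj.1 hi.left_mem hj.left_mem

lemma subsingleton_vCovers (x y : ℤ) : Set.Subsingleton {i | P.VCovers i x y} :=
  fun _ hi _ hj => P.vertical_edge_unique hi.1 hj.1 hi.bottom_mem hj.bottom_mem

open Classical in
/-- Horizontally neighbouring blocks are separated by the boundary if and only if an edge runs
between them. -/
lemma region_vertical_jump (x y : ℤ) :
    ¬ ((x - 1, y) ∈ P.region ↔ (x, y) ∈ P.region) ↔ ∃ i, P.VCovers i x y := by
  rw [← odd_card_iff_exists (P.subsingleton_vCovers x y)]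
  have hd : Disjoint (P.rayCrossings (x, y)) ({i | P.VCovers i x y} : Finset (Fin n)) := by
    rw [Finset.disjoint_left]
    intro i hi hj
    simp only [rayCrossings, Finset.mem_filter, Finset.mem_univ, true_and] at hi hj
    have := hj.2.1
    omega
  have hu : P.rayCrossings (x - 1, y) =
      P.rayCrossings (x, y) ∪ ({i | P.VCovers i x y} : Finset (Fin n)) := by
    ext i
    simp only [rayCrossings, Finset.mem_filter, Finset.mem_univ, true_and, Finset.mem_union]
    simp only [VCovers]
    omega
  simp only [region, Set.mem_ofPred_eq, hu, Finset.card_union_of_disjoint hd, Nat.odd_iff]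
  omega

open Classical in
/-- Vertically neighbouring blocks are separated by the boundary if and only if an edge runs
between them. -/
lemma region_horizontal_jump (x y : ℤ) :
    ¬ ((x, y - 1) ∈ P.region ↔ (x, y) ∈ P.region) ↔ ∃ i, P.HCovers i x y := by
  rw [← odd_card_iff_exists (P.subsingleton_hCovers x y)]
  -- `U` marks the vertices to the right of the column `x`, `D` those at height `y`.
  obtain ⟨U, hU⟩ : ∃ U : Fin n → ZMod 2, ∀ i, U i = if x < (P.vert i).1 then 1 else 0 :=
    ⟨_, fun _ => rfl⟩
  obtain ⟨D, hD⟩ : ∃ D : Fin n → ZMod 2, ∀ i, D i = if (P.vert i).2 = y then 1 else 0 :=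
    ⟨_, fun _ => rfl⟩
  -- A vertical edge to the right of `x` is hit by exactly one of the two rays if and only if
  -- exactly one of its ends is at height `y`. A horizontal edge at height `y` runs between the
  -- blocks if and only if exactly one of its ends is to the right of `x`. Each vertex belongs to
  -- two edges, so the right-hand sides add up to zero modulo 2.
  have hterm : ∀ i, ((if i ∈ P.rayCrossings (x, y - 1) then 1 else 0 : ZMod 2) +
      (if i ∈ P.rayCrossings (x, y) then 1 else 0)) +
      (if P.HCovers i x y then 1 else 0) = U i * D i + U (i + 1) * D (i + 1) := by
    intro i
    simp only [rayCrossings, Finset.mem_filter, Finset.mem_univ, true_and, hU, hD]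
    have h2 : (1 + 1 : ZMod 2) = 0 := by decide
    by_cases hC : P.HCovers i x y
    all_goals
      simp only [hC, if_true, if_false]
      rw [HCovers] at hC
      rcases P.axis i with ⟨h₁, h₂⟩ | ⟨h₁, h₂⟩
    all_goals
      split_ifs
      all_goals first
        | (exfalso; omega)
        | simp only [h2, mul_one, mul_zero, add_zero, zero_add]
  have hcyc : ∑ i, U (i + 1) * D (i + 1) = ∑ i, U i * D i :=
    Equiv.sum_comp (Equiv.addRight (1 : Fin n)) (fun i => U i * D i)
  have hsum := Finset.sum_congr (rfl : (Finset.univ : Finset (Fin n)) = _) (fun i _ => hterm i)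
  rw [Finset.sum_add_distrib, Finset.sum_add_distrib, Finset.sum_add_distrib, hcyc,
    CharTwo.add_self_eq_zero] at hsum
  simp only [Finset.sum_ite_mem, Finset.univ_inter, Finset.sum_const, nsmul_eq_mul, mul_one,
    Finset.sum_boole] at hsum
  have hev : Even ((P.rayCrossings (x, y - 1)).card + (P.rayCrossings (x, y)).card +
      (Finset.card {i | P.HCovers i x y})) := by
    rw [← ZMod.natCast_eq_zero_iff_even]
    push_cast
    exact hsum
  simp only [region, Set.mem_ofPred_eq, Nat.odd_iff, Nat.even_iff] at hev ⊢
  omega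

end OrthoPolygon

/-! ## Regions made of blocks -/

/-- `Q` is a bounded set of blocks all of whose corners lie in `V`. -/
structure HasVertices (Q : Set (ℤ × ℤ)) (V : Finset (ℤ × ℤ)) : Prop where
  straight : ∀ x y, (x, y) ∉ V →
    (((x - 1, y - 1) ∈ Q ↔ (x, y - 1) ∈ Q) ∧ ((x - 1, y) ∈ Q ↔ (x, y) ∈ Q)) ∨
    (((x - 1, y - 1) ∈ Q ↔ (x - 1, y) ∈ Q) ∧ ((x, y - 1) ∈ Q ↔ (x, y) ∈ Q))
  jump_y : ∀ x y, ¬ ((x, y - 1) ∈ Q ↔ (x, y) ∈ Q) → ∃ v ∈ V, v.2 = y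
  jump_x : ∀ x y, ¬ ((x - 1, y) ∈ Q ↔ (x, y) ∈ Q) → ∃ v ∈ V, v.1 = x
  bounded : ∃ M : ℤ, ∀ b ∈ Q, -M ≤ b.1 ∧ b.1 < M ∧ -M ≤ b.2 ∧ b.2 < M

/-- A valid square of the region `Q`. -/
def ValidIn (Q : Set (ℤ × ℤ)) (S : Rect) : Prop :=
  (0 < S.width ∧ 0 < S.height ∧ S.blocks ⊆ Q) ∧ S.width = S.height

/-- A rectangle in `Q` whose top and bottom sides lie on the boundary of `Q`. -/
structure HStrip (Q : Set (ℤ × ℤ)) (Y : Rect) : Prop where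
  width_pos : Y.left < Y.right
  height_pos : Y.bottom < Y.top
  subset : Y.blocks ⊆ Q
  above : ∀ x, Y.left ≤ x → x < Y.right → (x, Y.top) ∉ Q
  below : ∀ x, Y.left ≤ x → x < Y.right → (x, Y.bottom - 1) ∉ Q

/-- An inclusion-maximal `HStrip`. -/
def HMax (Q : Set (ℤ × ℤ)) (Y : Rect) : Prop :=
  HStrip Q Y ∧ ∀ Y', HStrip Q Y' → Y.blocks ⊆ Y'.blocks → Y' = Y

/-- Reflection in the diagonal. -/
def Rect.swap (R : Rect) : Rect := ⟨R.bottom, R.top, R.left, R.right⟩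

lemma Rect.mem_blocks {R : Rect} {b : ℤ × ℤ} :
    b ∈ R.blocks ↔ R.left ≤ b.1 ∧ b.1 < R.right ∧ R.bottom ≤ b.2 ∧ b.2 < R.top := Iff.rfl

lemma Rect.swap_swap (R : Rect) : R.swap.swap = R := rfl

lemma Rect.swap_injective : Function.Injective Rect.swap :=
  Function.LeftInverse.injective Rect.swap_swap

lemma Rect.mem_blocks_swap {R : Rect} {b : ℤ × ℤ} : b ∈ R.swap.blocks ↔ b.swap ∈ R.blocks := by
  simp only [Rect.mem_blocks, Rect.swap, Prod.fst_swap, Prod.snd_swap]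
  tauto

lemma Rect.swap_subset {R T : Rect} : R.swap.blocks ⊆ T.swap.blocks ↔ R.blocks ⊆ T.blocks := by
  constructor
  · intro h b hb
    have := @h b.swap (by simpa [Rect.mem_blocks_swap] using hb)
    simpa [Rect.mem_blocks_swap] using this
  · intro h b hb
    rw [Rect.mem_blocks_swap] at hb ⊢
    exact h hb

lemma Rect.blocks_subset_iff {R T : Rect} (hw : R.left < R.right) (hh : R.bottom < R.top) :
    R.blocks ⊆ T.blocks ↔
      T.left ≤ R.left ∧ R.right ≤ T.right ∧ T.bottom ≤ R.bottom ∧ R.top ≤ T.top := by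
  constructor
  · intro h
    have h₁ := @h (R.left, R.bottom) (by simp only [Rect.mem_blocks]; omega)
    have h₂ := @h (R.right - 1, R.top - 1) (by simp only [Rect.mem_blocks]; omega)
    simp only [Rect.mem_blocks] at h₁ h₂
    omega
  · intro h b hb
    simp only [Rect.mem_blocks] at hb ⊢
    omega

lemma ValidIn.swap {Q : Set (ℤ × ℤ)} {S : Rect} (h : ValidIn Q S) :
    ValidIn (Prod.swap ⁻¹' Q) S.swap :=
  ⟨⟨h.1.2.1, h.1.1, fun _ hb => h.1.2.2 (Rect.mem_blocks_swap.1 hb)⟩, h.2.symm⟩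

lemma ValidIn.of_swap {Q : Set (ℤ × ℤ)} {S : Rect} (h : ValidIn (Prod.swap ⁻¹' Q) S) :
    ValidIn Q S.swap := by
  have := h.swap
  rwa [← Set.preimage_comp, Prod.swap_swap_eq, Set.preimage_id] at this

lemma HasVertices.swap {Q : Set (ℤ × ℤ)} {V : Finset (ℤ × ℤ)} (h : HasVertices Q V) :
    HasVertices (Prod.swap ⁻¹' Q) (V.map (Equiv.prodComm ℤ ℤ).toEmbedding) where
  straight x y hxy := by
    have := h.straight y x (by simpa using hxy)
    simp only [Set.mem_preimage, Prod.swap_prod_mk]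
    tauto
  jump_y x y hxy := by
    obtain ⟨v, hv, rfl⟩ := h.jump_x y x hxy
    exact ⟨v.swap, by simpa using hv, rfl⟩
  jump_x x y hxy := by
    obtain ⟨v, hv, rfl⟩ := h.jump_y y x hxy
    exact ⟨v.swap, by simpa using hv, rfl⟩
  bounded := by
    obtain ⟨M, hM⟩ := h.bounded
    refine ⟨M, fun b hb => ?_⟩
    have := hM _ hb
    simp only [Prod.fst_swap, Prod.snd_swap] at this
    omega

/-! ### Strips of a region made of blocks -/

section HStrip

variable {Q : Set (ℤ × ℤ)} {Y Y' : Rect}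

/-- A rectangle in `Q` that overlaps a strip does not cross its long sides. -/
lemma HStrip.bottom_le_top_le (hY : HStrip Q Y) {R : Rect} (hR : R.blocks ⊆ Q)
    {b : ℤ × ℤ} (hb : b ∈ R.blocks) (hbY : b ∈ Y.blocks) :
    Y.bottom ≤ R.bottom ∧ R.top ≤ Y.top := by
  simp only [Rect.mem_blocks] at hb hbY
  constructor
  · by_contra! h
    exact hY.below b.1 hbY.1 hbY.2.1 (hR (by simp only [Rect.mem_blocks]; omega))
  · by_contra! h
    exact hY.above b.1 hbY.1 hbY.2.1 (hR (by simp only [Rect.mem_blocks]; omega))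

lemma HStrip.bottom_eq_top_eq (hY : HStrip Q Y) (hY' : HStrip Q Y') {b : ℤ × ℤ}
    (hb : b ∈ Y.blocks) (hb' : b ∈ Y'.blocks) : Y'.bottom = Y.bottom ∧ Y'.top = Y.top := by
  have h₁ := hY.bottom_le_top_le hY'.subset hb' hb
  have h₂ := hY'.bottom_le_top_le hY.subset hb hb'
  omega

/-- Overlapping strips have the same rows, so their union is again a rectangle between two boundary
lines. -/
lemma HStrip.union (hY : HStrip Q Y) (hY' : HStrip Q Y') {b : ℤ × ℤ}
    (hb : b ∈ Y.blocks) (hb' : b ∈ Y'.blocks) :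
    HStrip Q ⟨min Y.left Y'.left, max Y.right Y'.right, Y.bottom, Y.top⟩ := by
  obtain ⟨hbot, htop⟩ := hY.bottom_eq_top_eq hY' hb hb'
  simp only [Rect.mem_blocks] at hb hb'
  have hor : ∀ x, min Y.left Y'.left ≤ x → x < max Y.right Y'.right →
      (Y.left ≤ x ∧ x < Y.right) ∨ (Y'.left ≤ x ∧ x < Y'.right) := by
    intro x h₁ h₂
    omega
  refine ⟨?_, hY.height_pos, ?_, ?_, ?_⟩
  · dsimp only; omega
  · intro c hc
    simp only [Rect.mem_blocks] at hc
    rcases hor c.1 hc.1 hc.2.1 with h | h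
    · exact hY.subset (by simp only [Rect.mem_blocks]; omega)
    · exact hY'.subset (by simp only [Rect.mem_blocks]; omega)
  · intro x h₁ h₂
    rcases hor x h₁ h₂ with h | h
    · exact hY.above x h.1 h.2
    · rw [← htop]; exact hY'.above x h.1 h.2
  · intro x h₁ h₂
    rcases hor x h₁ h₂ with h | h
    · exact hY.below x h.1 h.2
    · rw [← hbot]; exact hY'.below x h.1 h.2

/-- Different maximal strips do not overlap. -/
lemma HMax.eq_of_mem (hY : HMax Q Y) (hY' : HMax Q Y') {b : ℤ × ℤ}
    (hb : b ∈ Y.blocks) (hb' : b ∈ Y'.blocks) : Y = Y' := by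
  obtain ⟨hbot, htop⟩ := hY.1.bottom_eq_top_eq hY'.1 hb hb'
  have hU := hY.1.union hY'.1 hb hb'
  have h₁ := hY.2 _ hU (by intro c hc; simp only [Rect.mem_blocks] at hc ⊢; omega)
  have h₂ := hY'.2 _ hU (by intro c hc; simp only [Rect.mem_blocks] at hc ⊢; omega)
  rw [← h₁, h₂]

/-- Strips of different orientations do not overlap. -/
lemma HStrip.not_mem_of_swap (hY : HStrip Q Y) (hw : Y.height < Y.width)
    (hY' : HStrip (Prod.swap ⁻¹' Q) Y'.swap) (hw' : Y'.width < Y'.height) {b : ℤ × ℤ}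
    (hb : b ∈ Y.blocks) (hb' : b ∈ Y'.blocks) : False := by
  have hs : Y'.blocks ⊆ Q := fun c hc =>
    @hY'.subset c.swap (by simpa [Rect.mem_blocks_swap] using hc)
  -- An overlap would give `Y'.height ≤ Y.height < Y.width ≤ Y'.width < Y'.height`.
  have h₁ := hY.bottom_le_top_le hs hb' hb
  have h₂ := hY'.bottom_le_top_le (R := Y.swap) (b := b.swap)
    (fun c hc => hY.subset (Rect.mem_blocks_swap.1 hc))
    (by simpa [Rect.mem_blocks_swap] using hb) (by simpa [Rect.mem_blocks_swap] using hb')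
  simp only [Rect.swap, Rect.width, Rect.height] at *
  omega

variable {V : Finset (ℤ × ℤ)}

/-- Every strip extends to a maximal one. -/
lemma HStrip.exists_hmax (hQ : HasVertices Q V) (hY : HStrip Q Y) :
    ∃ Z, HMax Q Z ∧ Y.blocks ⊆ Z.blocks ∧ Z.bottom = Y.bottom ∧ Z.top = Y.top := by
  obtain ⟨M, hM⟩ := hQ.bounded
  have hbd : ∀ Z : Rect, HStrip Q Z → Z.width ≤ 2 * M := by
    intro Z hZ
    have h₀ := hZ.width_pos
    have h₁ := hZ.height_pos
    have h₂ := hM _ (@hZ.subset (Z.left, Z.bottom) (by simp only [Rect.mem_blocks]; omega))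
    have h₃ := hM _ (@hZ.subset (Z.right - 1, Z.bottom) (by simp only [Rect.mem_blocks]; omega))
    simp only [Rect.width] at *
    omega
  let p : ℤ → Prop := fun w => ∃ Z, HStrip Q Z ∧ Y.blocks ⊆ Z.blocks ∧ Z.width = w
  obtain ⟨w, ⟨Z, hZ, hYZ, rfl⟩, hmax⟩ := Int.exists_greatest_of_bdd (P := p)
    ⟨2 * M, by rintro w ⟨Z, hZ, -, rfl⟩; exact hbd Z hZ⟩ ⟨Y.width, Y, hY, subset_rfl, rfl⟩
  have hc : (Y.left, Y.bottom) ∈ Y.blocks := by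
    have h₀ := hY.width_pos
    have h₁ := hY.height_pos
    simp only [Rect.mem_blocks]; omega
  refine ⟨Z, ⟨hZ, fun Z' hZ' hs => ?_⟩, hYZ, hY.bottom_eq_top_eq hZ hc (hYZ hc)⟩
  have hle := hmax _ ⟨Z', hZ', hYZ.trans hs, rfl⟩
  obtain ⟨hb, ht⟩ := hZ.bottom_eq_top_eq hZ' (hYZ hc) (hs (hYZ hc))
  have := (Rect.blocks_subset_iff hZ.width_pos hZ.height_pos).1 hs
  simp only [Rect.width] at hle
  ext <;> omega

/-- The left side of a maximal strip contains a vertex. -/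
lemma HMax.exists_vertex (hQ : HasVertices Q V) (hY : HMax Q Y) :
    ∃ v ∈ V, v.1 = Y.left ∧ Y.bottom ≤ v.2 ∧ v.2 ≤ Y.top := by
  obtain ⟨⟨hw, hh, hs, ha, hb⟩, hm⟩ := hY
  by_contra! hV
  have hst : ∀ y, Y.bottom ≤ y → y ≤ Y.top → _ := fun y h₁ h₂ =>
    hQ.straight Y.left y (fun h => (hV _ h rfl h₁).not_ge h₂)
  have hin : ∀ y, Y.bottom ≤ y → y < Y.top → (Y.left, y) ∈ Q := fun y h₁ h₂ =>
    hs (by simp only [Rect.mem_blocks]; omega)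
  have htop := ha Y.left le_rfl hw
  have hbot := hb Y.left le_rfl hw
  -- Without a vertex on the left side, the bottom boundary goes straight on past the lower left
  -- corner, so the block to the left of that corner block is in `Q`. Straightness at the points
  -- further up carries this along the whole column, and the strip could be extended by that column.
  have hcol : ∀ k : ℕ, Y.bottom + k < Y.top → (Y.left - 1, Y.bottom + k) ∈ Q := by
    intro k
    induction k with
    | zero =>
      intro hk
      have h₁ := hst Y.bottom le_rfl hh.le
      have h₂ := hin Y.bottom le_rfl hh
      simp only [Nat.cast_zero, add_zero]
      tauto
    | succ k ih =>
      intro hk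
      push_cast at hk ⊢
      have h₁ := hst (Y.bottom + (k + 1)) (by omega) (by omega)
      have h₂ := hin (Y.bottom + (k + 1)) (by omega) (by omega)
      have h₃ := hin (Y.bottom + k) (by omega) (by omega)
      have h₄ := ih (by omega)
      rw [show Y.bottom + ((k : ℤ) + 1) - 1 = Y.bottom + k by ring] at h₁
      tauto
  have hext : HStrip Q ⟨Y.left - 1, Y.right, Y.bottom, Y.top⟩ := by
    refine ⟨by dsimp only; omega, hh, ?_, ?_, ?_⟩
    · rintro ⟨x, y⟩ hc
      simp only [Rect.mem_blocks] at hc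
      by_cases hx : x = Y.left - 1
      · have := hcol (y - Y.bottom).toNat (by omega)
        rwa [show Y.bottom + ((y - Y.bottom).toNat : ℤ) = y by omega, ← hx] at this
      · exact hs (by simp only [Rect.mem_blocks]; omega)
    · intro x h₁ h₂
      by_cases hx : x = Y.left - 1
      · have h₃ := hst Y.top hh.le le_rfl
        have h₄ := hin (Y.top - 1) (by omega) (by omega)
        subst hx
        dsimp only
        tauto
      · exact ha x (by dsimp only at h₁; omega) h₂
    · intro x h₁ h₂
      by_cases hx : x = Y.left - 1
      · have h₃ := hst Y.bottom le_rfl hh.le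
        have h₄ := hin Y.bottom le_rfl hh
        subst hx
        dsimp only
        tauto
      · exact hb x (by dsimp only at h₁; omega) h₂
  have := hm _ hext (by intro c hc; simp only [Rect.mem_blocks] at hc ⊢; omega)
  have := congrArg Rect.left this
  dsimp only at this
  omega

end HStrip

/-! ## Counting squares with independent witnesses -/

/-- A family of valid squares, each with a witness block in it, such that no valid square covers
two of the witnesses. -/
structure IsIndependentFamily (Q : Set (ℤ × ℤ)) (𝒮 : Finset (Rect × (ℤ × ℤ))) : Prop where
  valid : ∀ a ∈ 𝒮, ValidIn Q a.1
  mem : ∀ a ∈ 𝒮, a.2 ∈ a.1.blocks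
  eq : ∀ a ∈ 𝒮, ∀ b ∈ 𝒮, ∀ T, ValidIn Q T → a.2 ∈ T.blocks → b.2 ∈ T.blocks → a = b

/-- The column `x` is at distance at least `2 * Y.height` from both ends of `Y`. -/
def HMid (Y : Rect) (x : ℤ) : Prop := Y.left + 2 * Y.height ≤ x ∧ x < Y.right - 2 * Y.height

/-- The top and the bottom side of `S` meet the boundary of `Q`. -/
def HBlocked (Q : Set (ℤ × ℤ)) (S : Rect) : Prop :=
  (∃ x, S.left ≤ x ∧ x < S.right ∧ (x, S.top) ∉ Q) ∧
    ∃ x, S.left ≤ x ∧ x < S.right ∧ (x, S.bottom - 1) ∉ Q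

/-- Witnesses in the middle part of a horizontal strip belong to a single square. -/
def HMidUnique (Q : Set (ℤ × ℤ)) (𝒮 : Finset (Rect × (ℤ × ℤ))) : Prop :=
  ∀ Y, HMax Q Y → Y.height < Y.width → ∀ a ∈ 𝒮, ∀ b ∈ 𝒮,
    a.1.blocks ⊆ Y.blocks → b.1.blocks ⊆ Y.blocks →
    a.1.bottom = Y.bottom → a.1.top = Y.top → b.1.bottom = Y.bottom → b.1.top = Y.top →
    HMid Y a.2.1 → HMid Y b.2.1 → a = b

variable {Q : Set (ℤ × ℤ)} {V : Finset (ℤ × ℤ)} {𝒮 : Finset (Rect × (ℤ × ℤ))}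

lemma IsIndependentFamily.mono (h : IsIndependentFamily Q 𝒮) {𝒯 : Finset (Rect × (ℤ × ℤ))}
    (hs : 𝒯 ⊆ 𝒮) : IsIndependentFamily Q 𝒯 :=
  ⟨fun a ha => h.valid a (hs ha), fun a ha => h.mem a (hs ha),
    fun a ha b hb => h.eq a (hs ha) b (hs hb)⟩

/-- Squares of an independent family with nested blocks coincide. -/
lemma IsIndependentFamily.eq_of_subset (h : IsIndependentFamily Q 𝒮)
    {a b : Rect × (ℤ × ℤ)} (ha : a ∈ 𝒮) (hb : b ∈ 𝒮) (hab : a.1.blocks ⊆ b.1.blocks) : a = b :=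
  h.eq a ha b hb b.1 (h.valid b hb) (hab (h.mem a ha)) (h.mem b hb)

/-- Two squares that have the same point as, say, lower left corner are nested. -/
lemma IsIndependentFamily.card_le_of_corner (h : IsIndependentFamily Q 𝒮)
    (hc : ∀ a ∈ 𝒮, ∃ v ∈ V, v ∈ a.1.corners) : 𝒮.card ≤ 4 * V.card := by
  let cor : Fin 4 → Rect → ℤ × ℤ := fun j R =>
    match j with
    | 0 => (R.left, R.bottom)
    | 1 => (R.left, R.top)
    | 2 => (R.right, R.bottom)
    | 3 => (R.right, R.top)
  have := Finset.card_le_card_of_forall_subsingleton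
    (s := 𝒮) (t := V ×ˢ (Finset.univ : Finset (Fin 4))) (fun a k => k.1 = cor k.2 a.1) ?_ ?_
  · simpa [mul_comm] using this
  · intro a ha
    obtain ⟨v, hv, hva⟩ := hc a ha
    simp only [Rect.corners, Set.mem_insert_iff, Set.mem_singleton_iff] at hva
    rcases hva with h | h | h | h
    · exact ⟨(v, 0), by simpa using hv, h⟩
    · exact ⟨(v, 1), by simpa using hv, h⟩
    · exact ⟨(v, 2), by simpa using hv, h⟩
    · exact ⟨(v, 3), by simpa using hv, h⟩
  · rintro ⟨v, j⟩ - a ⟨ha, hva⟩ b ⟨hb, hvb⟩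
    have hv : cor j a.1 = cor j b.1 := hva.symm.trans hvb
    obtain ⟨⟨ha₁, ha₂, -⟩, ha₃⟩ := h.valid a ha
    obtain ⟨⟨hb₁, hb₂, -⟩, hb₃⟩ := h.valid b hb
    simp only [Rect.width, Rect.height] at ha₁ ha₂ ha₃ hb₁ hb₂ hb₃
    have hsub : a.1.blocks ⊆ b.1.blocks ∨ b.1.blocks ⊆ a.1.blocks := by
      rw [Rect.blocks_subset_iff (by omega) (by omega), Rect.blocks_subset_iff (by omega) (by omega)]
      fin_cases j <;> simp only [cor, Prod.mk.injEq] at hv <;> omega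
    rcases hsub with hs | hs
    · exact h.eq_of_subset ha hb hs
    · exact (h.eq_of_subset hb ha hs).symm

/-- Two squares with the same horizontal sides, both touching the vertical line through `x`, whose
witnesses lie on the same side of that line, coincide. -/
lemma IsIndependentFamily.eq_of_same_rows (h : IsIndependentFamily Q 𝒮)
    {a b : Rect × (ℤ × ℤ)} (ha : a ∈ 𝒮) (hb : b ∈ 𝒮) (hbot : a.1.bottom = b.1.bottom)
    (htop : a.1.top = b.1.top) {x : ℤ} (hax : a.1.left ≤ x ∧ x ≤ a.1.right)
    (hbx : b.1.left ≤ x ∧ x ≤ b.1.right) (hside : a.2.1 < x ↔ b.2.1 < x) : a = b := by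
  have hma := h.mem a ha
  have hmb := h.mem b hb
  -- On the side of the line where both witnesses lie, the square that extends further contains the
  -- columns of the other.
  have hmem : (b.2 ∈ a.1.blocks) ∨ (a.2 ∈ b.1.blocks) := by
    simp only [Rect.mem_blocks] at *
    omega
  rcases hmem with hm | hm
  · exact h.eq a ha b hb _ (h.valid a ha) hma hm
  · exact h.eq a ha b hb _ (h.valid b hb) hm hmb

/-- The key is a vertex on the top side, a vertex at the height of the bottom side, and one bit for
the side of the first vertex on which the witness lies. This is all that `eq_of_same_rows` needs. -/
lemma IsIndependentFamily.card_le_of_top (h : IsIndependentFamily Q 𝒮)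
    (hv : ∀ a ∈ 𝒮, ∃ v ∈ V, v.2 = a.1.top ∧ a.1.left ≤ v.1 ∧ v.1 ≤ a.1.right)
    (hw : ∀ a ∈ 𝒮, ∃ w ∈ V, w.2 = a.1.bottom) : 𝒮.card ≤ 2 * V.card ^ 2 := by
  have := Finset.card_le_card_of_forall_subsingleton
    (s := 𝒮) (t := V ×ˢ V ×ˢ (Finset.univ : Finset Bool))
    (fun a k => (k.1.2 = a.1.top ∧ a.1.left ≤ k.1.1 ∧ k.1.1 ≤ a.1.right) ∧
      k.2.1.2 = a.1.bottom ∧ k.2.2 = decide (a.2.1 < k.1.1)) ?_ ?_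
  · simp only [Finset.card_product, Finset.card_univ, Fintype.card_bool] at this
    linarith [sq V.card]
  · intro a ha
    obtain ⟨v, hv, h₁⟩ := hv a ha
    obtain ⟨w, hw, h₂⟩ := hw a ha
    exact ⟨(v, w, decide (a.2.1 < v.1)),
      Finset.mem_product.2 ⟨hv, Finset.mem_product.2 ⟨hw, Finset.mem_univ _⟩⟩, h₁, h₂, rfl⟩
  · rintro ⟨v, w, s⟩ - a ⟨ha, ⟨ha₁, ha₂, ha₃⟩, ha₄, ha₅⟩ b ⟨hb, ⟨hb₁, hb₂, hb₃⟩, hb₄, hb₅⟩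
    exact h.eq_of_same_rows ha hb (ha₄.symm.trans hb₄) (ha₁.symm.trans hb₁) ⟨ha₂, ha₃⟩
      ⟨hb₂, hb₃⟩ (decide_eq_decide.1 (ha₅.symm.trans hb₅))

lemma IsIndependentFamily.card_le_of_bottom (h : IsIndependentFamily Q 𝒮)
    (hv : ∀ a ∈ 𝒮, ∃ v ∈ V, v.2 = a.1.bottom ∧ a.1.left ≤ v.1 ∧ v.1 ≤ a.1.right)
    (hw : ∀ a ∈ 𝒮, ∃ w ∈ V, w.2 = a.1.top) : 𝒮.card ≤ 2 * V.card ^ 2 := by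
  have := Finset.card_le_card_of_forall_subsingleton
    (s := 𝒮) (t := V ×ˢ V ×ˢ (Finset.univ : Finset Bool))
    (fun a k => (k.1.2 = a.1.bottom ∧ a.1.left ≤ k.1.1 ∧ k.1.1 ≤ a.1.right) ∧
      k.2.1.2 = a.1.top ∧ k.2.2 = decide (a.2.1 < k.1.1)) ?_ ?_
  · simp only [Finset.card_product, Finset.card_univ, Fintype.card_bool] at this
    linarith [sq V.card]
  · intro a ha
    obtain ⟨v, hv, h₁⟩ := hv a ha
    obtain ⟨w, hw, h₂⟩ := hw a ha
    exact ⟨(v, w, decide (a.2.1 < v.1)),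
      Finset.mem_product.2 ⟨hv, Finset.mem_product.2 ⟨hw, Finset.mem_univ _⟩⟩, h₁, h₂, rfl⟩
  · rintro ⟨v, w, s⟩ - a ⟨ha, ⟨ha₁, ha₂, ha₃⟩, ha₄, ha₅⟩ b ⟨hb, ⟨hb₁, hb₂, hb₃⟩, hb₄, hb₅⟩
    exact h.eq_of_same_rows ha hb (ha₁.symm.trans hb₁) (ha₄.symm.trans hb₄) ⟨ha₂, ha₃⟩
      ⟨hb₂, hb₃⟩ (decide_eq_decide.1 (ha₅.symm.trans hb₅))

/-- Two blocks of a rectangle in `Q` that are less than its height apart lie in a common valid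
square, provided that the rectangle is not higher than wide. -/
lemma exists_validIn_of_near {Y : Rect} (hY : Y.blocks ⊆ Q) (hw : Y.height ≤ Y.width)
    {b c : ℤ × ℤ} (hb : b ∈ Y.blocks) (hc : c ∈ Y.blocks) (h₁ : b.1 ≤ c.1)
    (h₂ : c.1 < b.1 + Y.height) :
    ∃ T, ValidIn Q T ∧ b ∈ T.blocks ∧ c ∈ T.blocks := by
  simp only [Rect.mem_blocks, Rect.width, Rect.height] at *
  -- The square starts at the left block `b`, or is pulled back so as to end with `Y`.
  refine ⟨⟨min b.1 (Y.right - (Y.top - Y.bottom)),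
    min b.1 (Y.right - (Y.top - Y.bottom)) + (Y.top - Y.bottom), Y.bottom, Y.top⟩,
    ⟨⟨?_, ?_, ?_⟩, ?_⟩, ?_, ?_⟩
  · simp only [Rect.width]; omega
  · simp only [Rect.height]; omega
  · refine fun e he => hY ?_
    simp only [Rect.mem_blocks] at he ⊢
    omega
  · simp only [Rect.width, Rect.height]; omega
  · dsimp only; omega
  · dsimp only; omega

/-- The zone of the strip `Y` that contains the column `x`: two zones of width `Y.height` at
either end, and the middle part. -/
def zone (Y : Rect) (x : ℤ) : Fin 5 :=
  if x < Y.left + Y.height then 0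
  else if x < Y.left + 2 * Y.height then 1
  else if Y.right - Y.height ≤ x then 2
  else if Y.right - 2 * Y.height ≤ x then 3
  else 4

/-- An end zone is as long as `Y` is high, so two of its columns are close enough for
`exists_validIn_of_near`. Only the middle part escapes this argument. -/
lemma zone_eq {Y : Rect} {x x' : ℤ} (hx : Y.left ≤ x ∧ x < Y.right)
    (hx' : Y.left ≤ x' ∧ x' < Y.right) (h : zone Y x = zone Y x') :
    (x ≤ x' ∧ x' < x + Y.height) ∨ (x' ≤ x ∧ x < x' + Y.height) ∨ (HMid Y x ∧ HMid Y x') := by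
  unfold zone at h
  unfold HMid
  split_ifs at h <;> omega

/-- A maximal strip has a vertex on its left side and contains one of the two blocks to the right of
that vertex. Maximal strips do not overlap, so vertex and block determine the strip. The factor 10
is two blocks times five zones. -/
lemma IsIndependentFamily.card_le_of_hStrip (h : IsIndependentFamily Q 𝒮)
    (hQ : HasVertices Q V) (hs : ∀ a ∈ 𝒮, HStrip Q a.1) (hm : HMidUnique Q 𝒮) :
    𝒮.card ≤ 10 * V.card := by
  have := Finset.card_le_card_of_forall_subsingleton
    (s := 𝒮) (t := V ×ˢ (Finset.univ : Finset Bool) ×ˢ (Finset.univ : Finset (Fin 5)))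
    (fun a k => ∃ Y, HMax Q Y ∧ a.1.blocks ⊆ Y.blocks ∧ Y.bottom = a.1.bottom ∧
      Y.top = a.1.top ∧ (k.1.1, if k.2.1 then k.1.2 else k.1.2 - 1) ∈ Y.blocks ∧
      k.2.2 = zone Y a.2.1) ?_ ?_
  · simp only [Finset.card_product, Finset.card_univ, Fintype.card_bool, Fintype.card_fin] at this
    linarith
  · intro a ha
    obtain ⟨Y, hY, hsub, hbot, htop⟩ := (hs a ha).exists_hmax hQ
    obtain ⟨v, hv, h₁, h₂, h₃⟩ := hY.exists_vertex hQ
    have hw := hY.1.width_pos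
    have hh := hY.1.height_pos
    -- The block above the vertex lies in `Y` unless the vertex is the upper left corner; then the
    -- block below does.
    have hmem : (v.1, if decide (v.2 < Y.top) = true then v.2 else v.2 - 1) ∈ Y.blocks := by
      rw [Rect.mem_blocks]
      by_cases hlt : v.2 < Y.top
      · rw [if_pos (decide_eq_true hlt)]
        dsimp only
        omega
      · rw [if_neg (by rwa [decide_eq_true_eq])]
        dsimp only
        omega
    exact ⟨(v, decide (v.2 < Y.top), zone Y a.2.1),
      Finset.mem_product.2 ⟨hv, Finset.mem_univ _⟩, Y, hY, hsub, hbot, htop, hmem, rfl⟩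
  · rintro ⟨v, s, j⟩ - a ⟨ha, Y, hY, hsa, hba, hta, hva, hja⟩ b ⟨hb, Y', hY', hsb, hbb, htb, hvb, hjb⟩
    obtain rfl := hY.eq_of_mem hY' hva hvb
    have hma := hsa (h.mem a ha)
    have hmb := hsb (h.mem b hb)
    have hw : Y.height ≤ Y.width := by
      have h₁ := (h.valid a ha).2
      have h₂ := (Rect.blocks_subset_iff (hs a ha).width_pos (hs a ha).height_pos).1 hsa
      simp only [Rect.width, Rect.height] at *
      omega
    rcases zone_eq (Y := Y) (x := a.2.1) (x' := b.2.1) ⟨hma.1, hma.2.1⟩ ⟨hmb.1, hmb.2.1⟩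
      (hja.symm.trans hjb) with hz | hz | hz
    · obtain ⟨T, hT, h₁, h₂⟩ := exists_validIn_of_near hY.1.subset hw hma hmb hz.1 hz.2
      exact h.eq a ha b hb T hT h₁ h₂
    · obtain ⟨T, hT, h₁, h₂⟩ := exists_validIn_of_near hY.1.subset hw hmb hma hz.1 hz.2
      exact h.eq a ha b hb T hT h₂ h₁
    · have hwlt : Y.height < Y.width := by
        have := hY.1.height_pos
        simp only [HMid, Rect.width, Rect.height] at *
        omega
      exact hm Y hY hwlt a ha b hb hsa hsb hba.symm hta.symm hbb.symm htb.symm hz.1 hz.2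

/-- A property of the integers in an interval that passes from neighbour to neighbour holds
throughout if it holds somewhere. -/
lemma forall_of_exists_of_step {p : ℤ → Prop} {l r : ℤ}
    (hstep : ∀ x, l < x → x < r → (p (x - 1) ↔ p x)) (hex : ∃ x, l ≤ x ∧ x < r ∧ p x) :
    ∀ x, l ≤ x → x < r → p x := by
  obtain ⟨x₀, h₀, h₁, hp⟩ := hex
  have hr : ∀ k : ℕ, l + k < r → (p (l + k) ↔ p l) := by
    intro k
    induction k with
    | zero => simp
    | succ k ih =>
      intro hk
      push_cast at hk ⊢
      rw [← ih (by omega), ← hstep (l + (k + 1)) (by omega) (by omega)]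
      rw [show l + ((k : ℤ) + 1) - 1 = l + k by ring]
  have key : ∀ x, l ≤ x → x < r → (p x ↔ p l) := by
    intro x h₂ h₃
    have := hr (x - l).toNat (by omega)
    rwa [show l + ((x - l).toNat : ℤ) = x by omega] at this
  intro x h₂ h₃
  rw [key x h₂ h₃, ← key x₀ h₀ h₁]
  exact hp

/-- Along a side without vertices the boundary neither starts nor stops, so one blocked position
blocks the whole side. -/
lemma hStrip_of_hBlocked (hQ : HasVertices Q V) {S : Rect} (hS : ValidIn Q S)
    (hB : HBlocked Q S)
    (ht : ¬ ∃ v ∈ V, v.2 = S.top ∧ S.left ≤ v.1 ∧ v.1 ≤ S.right)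
    (hb : ¬ ∃ v ∈ V, v.2 = S.bottom ∧ S.left ≤ v.1 ∧ v.1 ≤ S.right) : HStrip Q S := by
  obtain ⟨⟨hw, hh, hsub⟩, -⟩ := hS
  simp only [Rect.width, Rect.height] at hw hh
  refine ⟨by omega, by omega, hsub, ?_, ?_⟩
  · refine forall_of_exists_of_step (p := fun x => (x, S.top) ∉ Q) (fun x h₁ h₂ => ?_) hB.1
    have h₃ := hQ.straight x S.top (fun h => ht ⟨_, h, rfl, by dsimp only; omega, h₂.le⟩)
    have h₄ := @hsub (x, S.top - 1) (by simp only [Rect.mem_blocks]; omega)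
    have h₅ := @hsub (x - 1, S.top - 1) (by simp only [Rect.mem_blocks]; omega)
    tauto
  · refine forall_of_exists_of_step (p := fun x => (x, S.bottom - 1) ∉ Q) (fun x h₁ h₂ => ?_) hB.2
    have h₃ := hQ.straight x S.bottom (fun h => hb ⟨_, h, rfl, by dsimp only; omega, h₂.le⟩)
    have h₄ := @hsub (x, S.bottom) (by simp only [Rect.mem_blocks]; omega)
    have h₅ := @hsub (x - 1, S.bottom) (by simp only [Rect.mem_blocks]; omega)
    tauto

open Classical in
-- The constant is `2 + 2 + 10`: a vertex on the top side, a vertex on the bottom side, or neither,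
-- in which case the square is a strip section.
lemma IsIndependentFamily.card_le_of_hBlocked (h : IsIndependentFamily Q 𝒮)
    (hQ : HasVertices Q V) (hB : ∀ a ∈ 𝒮, HBlocked Q a.1) (hm : HMidUnique Q 𝒮) :
    𝒮.card ≤ 14 * V.card ^ 2 := by
  let pt : Rect × (ℤ × ℤ) → Prop := fun a =>
    ∃ v ∈ V, v.2 = a.1.top ∧ a.1.left ≤ v.1 ∧ v.1 ≤ a.1.right
  let pb : Rect × (ℤ × ℤ) → Prop := fun a =>
    ∃ v ∈ V, v.2 = a.1.bottom ∧ a.1.left ≤ v.1 ∧ v.1 ≤ a.1.right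
  have hyt : ∀ a ∈ 𝒮, ∃ w ∈ V, w.2 = a.1.top := by
    intro a ha
    obtain ⟨x, h₁, h₂, h₃⟩ := (hB a ha).1
    refine hQ.jump_y x _ fun hx => h₃ (hx.1 ((h.valid a ha).1.2.2 ?_))
    have := (h.valid a ha).1.2.1
    simp only [Rect.mem_blocks, Rect.height] at *
    omega
  have hyb : ∀ a ∈ 𝒮, ∃ w ∈ V, w.2 = a.1.bottom := by
    intro a ha
    obtain ⟨x, h₁, h₂, h₃⟩ := (hB a ha).2
    refine hQ.jump_y x _ fun hx => h₃ (hx.2 ((h.valid a ha).1.2.2 ?_))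
    have := (h.valid a ha).1.2.1
    simp only [Rect.mem_blocks, Rect.height] at *
    omega
  have h₁ : (𝒮.filter pt).card ≤ 2 * V.card ^ 2 :=
    (h.mono (Finset.filter_subset _ _)).card_le_of_top (fun a ha => (Finset.mem_filter.1 ha).2)
      (fun a ha => hyb a (Finset.mem_filter.1 ha).1)
  have h₂ : (𝒮.filter pb).card ≤ 2 * V.card ^ 2 :=
    (h.mono (Finset.filter_subset _ _)).card_le_of_bottom (fun a ha => (Finset.mem_filter.1 ha).2)
      (fun a ha => hyt a (Finset.mem_filter.1 ha).1)
  have h₃ : (𝒮.filter fun a => ¬ pt a ∧ ¬ pb a).card ≤ 10 * V.card :=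
    (h.mono (Finset.filter_subset _ _)).card_le_of_hStrip hQ
      (fun a ha => by
        obtain ⟨ha, hpt, hpb⟩ := Finset.mem_filter.1 ha
        exact hStrip_of_hBlocked hQ (h.valid a ha) (hB a ha) hpt hpb)
      (fun Y hY hw a ha b hb =>
        hm Y hY hw a (Finset.mem_filter.1 ha).1 b (Finset.mem_filter.1 hb).1)
  have hcov : 𝒮 ⊆ 𝒮.filter pt ∪ (𝒮.filter pb ∪ 𝒮.filter fun a => ¬ pt a ∧ ¬ pb a) := by
    intro a ha
    simp only [Finset.mem_union, Finset.mem_filter, ha, true_and]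
    tauto
  have h₄ := (Finset.card_le_card hcov).trans (Finset.card_union_le _ _)
  have h₅ := Finset.card_union_le (𝒮.filter pb) (𝒮.filter fun a => ¬ pt a ∧ ¬ pb a)
  have h₆ : V.card ≤ V.card ^ 2 := Nat.le_self_pow two_ne_zero _
  omega

/-- A maximal square whose sides are not blocked in opposite pairs has a vertex as a corner. -/
lemma exists_corner_of_maximal (hQ : HasVertices Q V) {S : Rect} (hS : ValidIn Q S)
    (hmax : ∀ T, ValidIn Q T → S.blocks ⊆ T.blocks → ¬ S.width < T.width)
    (hH : ¬ HBlocked Q S) (hV : ¬ HBlocked (Prod.swap ⁻¹' Q) S.swap) :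
    ∃ v ∈ V, v ∈ S.corners := by
  obtain ⟨⟨hw, hh, hsub⟩, heq⟩ := hS
  simp only [Rect.width, Rect.height] at hw hh heq
  have hin : ∀ x y, S.left ≤ x → x < S.right → S.bottom ≤ y → y < S.top → (x, y) ∈ Q :=
    fun x y h₁ h₂ h₃ h₄ => hsub ⟨h₁, h₂, h₃, h₄⟩
  have hno : ∀ T : Rect, T.width = S.width + 1 → T.height = S.height + 1 →
      S.blocks ⊆ T.blocks → ¬ T.blocks ⊆ Q := by
    intro T h₁ h₂ h₃ h₄
    refine hmax T ⟨⟨?_, ?_, h₄⟩, ?_⟩ h₃ ?_ <;> simp only [Rect.width, Rect.height] at * <;> omega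
  have hH' : (∀ x, S.left ≤ x → x < S.right → (x, S.top) ∈ Q) ∨
      (∀ x, S.left ≤ x → x < S.right → (x, S.bottom - 1) ∈ Q) := by
    unfold HBlocked at hH
    push Not at hH
    by_contra! hc
    obtain ⟨⟨x, h₁⟩, x', h₂, h₃, h₄⟩ := hc
    exact h₄ (hH ⟨x, h₁⟩ x' h₂ h₃)
  have hV' : (∀ y, S.bottom ≤ y → y < S.top → (S.right, y) ∈ Q) ∨
      (∀ y, S.bottom ≤ y → y < S.top → (S.left - 1, y) ∈ Q) := by
    unfold HBlocked at hV
    push Not at hV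
    by_contra! hc
    obtain ⟨⟨x, h₁⟩, x', h₂, h₃, h₄⟩ := hc
    exact h₄ (hV ⟨x, h₁⟩ x' h₂ h₃)
  by_contra! hcor
  have hc : ∀ x y, (x = S.left ∨ x = S.right) → (y = S.bottom ∨ y = S.top) → (x, y) ∉ V := by
    intro x y hx hy hv
    refine hcor _ hv ?_
    simp only [Rect.corners, Set.mem_insert_iff, Set.mem_singleton_iff, Prod.mk.injEq]
    tauto
  -- The square grows by one towards the two free sides. Of the four blocks at their common corner,
  -- the three outside the new corner position are in `Q`; if the corner is not a vertex,
  -- straightness puts the fourth in `Q` as well.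
  rcases hH' with ht | hb <;> rcases hV' with hr | hl
  · refine hno ⟨S.left, S.right + 1, S.bottom, S.top + 1⟩ ?_ ?_ ?_ ?_
    · simp only [Rect.width]; omega
    · simp only [Rect.height]; omega
    · intro c hc; simp only [Rect.mem_blocks] at hc ⊢; omega
    · rintro ⟨x, y⟩ hxy
      simp only [Rect.mem_blocks] at hxy
      by_cases hx : x = S.right <;> by_cases hy : y = S.top
      · have h₀ := hQ.straight S.right S.top (hc _ _ (.inr rfl) (.inr rfl))
        have h₁ := hin (S.right - 1) (S.top - 1) (by omega) (by omega) (by omega) (by omega)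
        have h₂ := ht (S.right - 1) (by omega) (by omega)
        have h₃ := hr (S.top - 1) (by omega) (by omega)
        subst hx hy
        tauto
      · subst hx; exact hr y (by omega) (by omega)
      · subst hy; exact ht x (by omega) (by omega)
      · exact hin x y (by omega) (by omega) (by omega) (by omega)
  · refine hno ⟨S.left - 1, S.right, S.bottom, S.top + 1⟩ ?_ ?_ ?_ ?_
    · simp only [Rect.width]; omega
    · simp only [Rect.height]; omega
    · intro c hc; simp only [Rect.mem_blocks] at hc ⊢; omega
    · rintro ⟨x, y⟩ hxy
      simp only [Rect.mem_blocks] at hxy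
      by_cases hx : x = S.left - 1 <;> by_cases hy : y = S.top
      · have h₀ := hQ.straight S.left S.top (hc _ _ (.inl rfl) (.inr rfl))
        have h₁ := hin S.left (S.top - 1) (by omega) (by omega) (by omega) (by omega)
        have h₂ := ht S.left (by omega) (by omega)
        have h₃ := hl (S.top - 1) (by omega) (by omega)
        subst hx hy
        tauto
      · subst hx; exact hl y (by omega) (by omega)
      · subst hy; exact ht x (by omega) (by omega)
      · exact hin x y (by omega) (by omega) (by omega) (by omega)
  · refine hno ⟨S.left, S.right + 1, S.bottom - 1, S.top⟩ ?_ ?_ ?_ ?_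
    · simp only [Rect.width]; omega
    · simp only [Rect.height]; omega
    · intro c hc; simp only [Rect.mem_blocks] at hc ⊢; omega
    · rintro ⟨x, y⟩ hxy
      simp only [Rect.mem_blocks] at hxy
      by_cases hx : x = S.right <;> by_cases hy : y = S.bottom - 1
      · have h₀ := hQ.straight S.right S.bottom (hc _ _ (.inr rfl) (.inl rfl))
        have h₁ := hin (S.right - 1) S.bottom (by omega) (by omega) (by omega) (by omega)
        have h₂ := hb (S.right - 1) (by omega) (by omega)
        have h₃ := hr S.bottom (by omega) (by omega)
        subst hx hy
        tauto
      · subst hx; exact hr y (by omega) (by omega)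
      · subst hy; exact hb x (by omega) (by omega)
      · exact hin x y (by omega) (by omega) (by omega) (by omega)
  · refine hno ⟨S.left - 1, S.right, S.bottom - 1, S.top⟩ ?_ ?_ ?_ ?_
    · simp only [Rect.width]; omega
    · simp only [Rect.height]; omega
    · intro c hc; simp only [Rect.mem_blocks] at hc ⊢; omega
    · rintro ⟨x, y⟩ hxy
      simp only [Rect.mem_blocks] at hxy
      by_cases hx : x = S.left - 1 <;> by_cases hy : y = S.bottom - 1
      · have h₀ := hQ.straight S.left S.bottom (hc _ _ (.inl rfl) (.inl rfl))
        have h₁ := hin S.left S.bottom (by omega) (by omega) (by omega) (by omega)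
        have h₂ := hb S.left (by omega) (by omega)
        have h₃ := hl S.bottom (by omega) (by omega)
        subst hx hy
        tauto
      · subst hx; exact hl y (by omega) (by omega)
      · subst hy; exact hb x (by omega) (by omega)
      · exact hin x y (by omega) (by omega) (by omega) (by omega)

/-- Reflection in the diagonal of a square with a witness block. -/
def swapPair : Rect × (ℤ × ℤ) ↪ Rect × (ℤ × ℤ) :=
  ⟨Prod.map Rect.swap Prod.swap, Rect.swap_injective.prodMap Prod.swap_injective⟩

lemma IsIndependentFamily.swap (h : IsIndependentFamily Q 𝒮) :
    IsIndependentFamily (Prod.swap ⁻¹' Q) (𝒮.map swapPair) where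
  valid := by
    simp only [Finset.mem_map]
    rintro _ ⟨a, ha, rfl⟩
    exact (h.valid a ha).swap
  mem := by
    simp only [Finset.mem_map]
    rintro _ ⟨a, ha, rfl⟩
    exact Rect.mem_blocks_swap.2 (h.mem a ha)
  eq := by
    simp only [Finset.mem_map]
    rintro _ ⟨a, ha, rfl⟩ _ ⟨b, hb, rfl⟩ T hT haT hbT
    rw [h.eq a ha b hb _ hT.of_swap (Rect.mem_blocks_swap.2 haT) (Rect.mem_blocks_swap.2 hbT)]

open Classical in
/-- The number of maximal squares with independent witnesses is quadratic in the number of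
vertices. -/
lemma IsIndependentFamily.card_le (h : IsIndependentFamily Q 𝒮) (hQ : HasVertices Q V)
    (hmax : ∀ a ∈ 𝒮, ∀ T, ValidIn Q T → a.1.blocks ⊆ T.blocks → ¬ a.1.width < T.width)
    (hH : HMidUnique Q 𝒮) (hV : HMidUnique (Prod.swap ⁻¹' Q) (𝒮.map swapPair)) :
    𝒮.card ≤ 32 * V.card ^ 2 := by
  let pH : Rect × (ℤ × ℤ) → Prop := fun a => HBlocked Q a.1
  let pV : Rect × (ℤ × ℤ) → Prop := fun a => HBlocked (Prod.swap ⁻¹' Q) a.1.swap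
  have h₁ : (𝒮.filter pH).card ≤ 14 * V.card ^ 2 :=
    (h.mono (Finset.filter_subset _ _)).card_le_of_hBlocked hQ
      (fun a ha => (Finset.mem_filter.1 ha).2)
      (fun Y hY hw a ha b hb =>
        hH Y hY hw a (Finset.mem_filter.1 ha).1 b (Finset.mem_filter.1 hb).1)
  have h₂ : (𝒮.filter pV).card ≤ 14 * V.card ^ 2 := by
    have hsub : (𝒮.filter pV).map swapPair ⊆ 𝒮.map swapPair :=
      Finset.map_subset_map.2 (Finset.filter_subset _ _)
    have := (h.swap.mono hsub).card_le_of_hBlocked hQ.swap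
      (by
        simp only [Finset.mem_map]
        rintro _ ⟨a, ha, rfl⟩
        exact (Finset.mem_filter.1 ha).2)
      (fun Y hY hw a ha b hb => hV Y hY hw a (hsub ha) b (hsub hb))
    simpa only [Finset.card_map] using this
  have h₃ : (𝒮.filter fun a => ¬ pH a ∧ ¬ pV a).card ≤ 4 * V.card :=
    (h.mono (Finset.filter_subset _ _)).card_le_of_corner
      (fun a ha => by
        obtain ⟨ha, hpH, hpV⟩ := Finset.mem_filter.1 ha
        exact exists_corner_of_maximal hQ (h.valid a ha) (hmax a ha) hpH hpV)
  have hcov : 𝒮 ⊆ 𝒮.filter pH ∪ (𝒮.filter pV ∪ 𝒮.filter fun a => ¬ pH a ∧ ¬ pV a) := by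
    intro a ha
    simp only [Finset.mem_union, Finset.mem_filter, ha, true_and]
    tauto
  have h₄ := (Finset.card_le_card hcov).trans (Finset.card_union_le _ _)
  have h₅ := Finset.card_union_le (𝒮.filter pV) (𝒮.filter fun a => ¬ pH a ∧ ¬ pV a)
  have h₆ : V.card ≤ V.card ^ 2 := Nat.le_self_pow two_ne_zero _
  omega

/-! ### The interior of a polygon as a region made of blocks -/

namespace OrthoPolygon

variable {n : ℕ} [NeZero n] (P : OrthoPolygon n)

/-- The set of vertices of `P`. -/
def vertices : Finset (ℤ × ℤ) := Finset.univ.image P.vert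

lemma card_vertices_le : P.vertices.card ≤ n :=
  Finset.card_image_le.trans (by simp)

lemma vert_mem_vertices (i : Fin n) : P.vert i ∈ P.vertices :=
  Finset.mem_image_of_mem _ (Finset.mem_univ i)

variable {P}

lemma mem_vertices_of_eq {i : Fin n} {x y : ℤ} (h₁ : (P.vert i).1 = x) (h₂ : (P.vert i).2 = y) :
    (x, y) ∈ P.vertices := by
  rw [← h₁, ← h₂]
  exact P.vert_mem_vertices i

lemma hCovers_iff_of_notMem {x y : ℤ} (h : (x, y) ∉ P.vertices) (i : Fin n) :
    P.HCovers i (x - 1) y ↔ P.HCovers i x y := by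
  have h₁ := fun h₁ h₂ => h (mem_vertices_of_eq (i := i) h₁ h₂)
  have h₂ := fun h₁ h₂ => h (mem_vertices_of_eq (i := i + 1) h₁ h₂)
  simp only [HCovers]
  constructor <;> rintro ⟨h₃, h₄, h₅, h₆⟩ <;>
    refine ⟨h₃, h₄, ?_, ?_⟩ <;> by_contra hc
  all_goals
    rcases le_total (P.vert i).1 (P.vert (i + 1)).1 with hle | hle
    · first
        | exact h₁ (by omega) (by omega)
        | exact h₂ (by omega) (by omega)
    · first
        | exact h₁ (by omega) (by omega)
        | exact h₂ (by omega) (by omega)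

lemma vCovers_iff_of_notMem {x y : ℤ} (h : (x, y) ∉ P.vertices) (i : Fin n) :
    P.VCovers i x (y - 1) ↔ P.VCovers i x y := by
  have h₁ := fun h₁ h₂ => h (mem_vertices_of_eq (i := i) h₁ h₂)
  have h₂ := fun h₁ h₂ => h (mem_vertices_of_eq (i := i + 1) h₁ h₂)
  simp only [VCovers]
  constructor <;> rintro ⟨h₃, h₄, h₅, h₆⟩ <;>
    refine ⟨h₃, h₄, ?_, ?_⟩ <;> by_contra hc
  all_goals
    rcases le_total (P.vert i).2 (P.vert (i + 1)).2 with hle | hle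
    · first
        | exact h₁ (by omega) (by omega)
        | exact h₂ (by omega) (by omega)
    · first
        | exact h₁ (by omega) (by omega)
        | exact h₂ (by omega) (by omega)

/-- Edges that meet are consecutive, and perpendicular consecutive edges meet only in their common
vertex. -/
lemma mem_vertices_of_hCovers_of_vCovers {i j : Fin n} {x y : ℤ} (hi : P.HCovers i x y)
    (hj : P.VCovers j x y) : (x, y) ∈ P.vertices := by
  rcases P.consecutive_of_mem hi.left_mem hj.bottom_mem with rfl | rfl | rfl
  · have := hi.1
    have := hj.1
    rcases P.axis i with h | h <;> tauto
  · exact mem_vertices_of_eq hj.2.1 (hi.1.symm.trans hi.2.1)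
  · exact mem_vertices_of_eq (hj.1.symm.trans hj.2.1) hi.2.1

variable (P)

lemma exists_vertex_bound : ∃ N : ℤ, ∀ i, -N ≤ (P.vert i).1 ∧ (P.vert i).1 ≤ N ∧
    -N ≤ (P.vert i).2 ∧ (P.vert i).2 ≤ N := by
  refine ⟨∑ i, (|(P.vert i).1| + |(P.vert i).2|), fun i => ?_⟩
  have h := Finset.single_le_sum (f := fun i => |(P.vert i).1| + |(P.vert i).2|)
    (fun i _ => by positivity) (Finset.mem_univ i)
  have h₁ := abs_le.1 (le_refl |(P.vert i).1|)
  have h₂ := abs_le.1 (le_refl |(P.vert i).2|)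
  have h₃ := abs_nonneg (P.vert i).1
  have h₄ := abs_nonneg (P.vert i).2
  omega

lemma region_bounded :
    ∃ M : ℤ, ∀ b ∈ P.region, -M ≤ b.1 ∧ b.1 < M ∧ -M ≤ b.2 ∧ b.2 < M := by
  obtain ⟨N, hN⟩ := P.exists_vertex_bound
  have hray : ∀ b ∈ P.region, b.1 < N ∧ -N ≤ b.2 ∧ b.2 < N := by
    intro b hb
    obtain ⟨i, hi⟩ := Finset.card_pos.1 (Odd.pos hb)
    simp only [rayCrossings, Finset.mem_filter, Finset.mem_univ, true_and] at hi
    have h₁ := hN i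
    have h₂ := hN (i + 1)
    omega
  refine ⟨N, fun b hb => ⟨?_, hray b hb⟩⟩
  -- Rays to the right give no bound on the left. Going up the column of `b` one must leave the
  -- region, and the horizontal edge crossed there bounds the column.
  obtain ⟨y, hy, hy'⟩ : ∃ y, (b.1, y) ∈ P.region ∧ (b.1, y + 1) ∉ P.region := by
    by_contra! hc
    have hk : ∀ k : ℕ, (b.1, b.2 + k) ∈ P.region := by
      intro k
      induction k with
      | zero => simpa using hb
      | succ k ih =>
        have := hc _ ih
        push_cast
        rwa [← add_assoc]
    have h₁ := hray _ (hk (N - b.2).toNat)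
    dsimp only at h₁
    omega
  obtain ⟨i, hi⟩ := (P.region_horizontal_jump b.1 (y + 1)).1 (by
    rw [add_sub_cancel_right]
    tauto)
  have h₁ := hN i
  have h₂ := hN (i + 1)
  have h₃ := hi.2.2
  omega

/-- At a point that is not a vertex, horizontal and vertical edges cannot both be present, and an
edge on one side of the point continues on the other. Hence the boundary is straight there. -/
lemma hasVertices : HasVertices P.region P.vertices where
  straight x y hxy := by
    by_cases hH : ∃ i, P.HCovers i x y
    · left
      obtain ⟨i, hi⟩ := hH
      have h₁ : ¬ ∃ j, P.VCovers j x y := fun ⟨j, hj⟩ =>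
        hxy (mem_vertices_of_hCovers_of_vCovers hi hj)
      have h₂ : ¬ ∃ j, P.VCovers j x (y - 1) := by
        simpa only [vCovers_iff_of_notMem hxy] using h₁
      rw [← region_vertical_jump, not_not] at h₁ h₂
      exact ⟨h₂, h₁⟩
    · right
      have h₂ : ¬ ∃ j, P.HCovers j (x - 1) y := by
        simpa only [hCovers_iff_of_notMem hxy] using hH
      rw [← region_horizontal_jump, not_not] at hH h₂
      exact ⟨h₂, hH⟩
  jump_y x y hxy := by
    obtain ⟨i, hi⟩ := (P.region_horizontal_jump x y).1 hxy
    exact ⟨_, P.vert_mem_vertices i, hi.2.1⟩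
  jump_x x y hxy := by
    obtain ⟨i, hi⟩ := (P.region_vertical_jump x y).1 hxy
    exact ⟨_, P.vert_mem_vertices i, hi.2.1⟩
  bounded := P.region_bounded

/-! ## Strips -/

variable {P}

/-- Adjacent unit segments share a lattice point, and horizontal edges with a common point coincide.
So a side that lies on the boundary piece by piece lies in a single edge. -/
lemma exists_edge_of_forall_hCovers {l r y : ℤ} (hlr : l < r)
    (h : ∀ x, l ≤ x → x < r → ∃ i, P.HCovers i x y) :
    ∃ i, Set.Icc (l, y) (r, y) ⊆ P.edge i := by
  obtain ⟨i, hi⟩ := h l le_rfl hlr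
  have hall := forall_of_exists_of_step (p := fun x => P.HCovers i x y) (l := l) (r := r)
    (fun x h₁ h₂ => by
      obtain ⟨j, hj⟩ := h (x - 1) (by omega) (by omega)
      obtain ⟨k, hk⟩ := h x (by omega) (by omega)
      have hjk : j = k := P.horizontal_edge_unique hj.1 hk.1
        (by simpa only [sub_add_cancel] using hj.right_mem) hk.left_mem
      subst hjk
      constructor
      · intro hi'
        rwa [P.subsingleton_hCovers _ _ hi' hj]
      · intro hi'
        rwa [P.subsingleton_hCovers _ _ hi' hk]) ⟨l, le_rfl, hlr, hi⟩
  refine ⟨i, fun c hc => ?_⟩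
  obtain ⟨⟨h₁, h₂⟩, h₃, h₄⟩ := hc
  have h₅ := hall (r - 1) (by omega) (by omega)
  simp only [HCovers] at hi h₅
  dsimp only at h₁ h₂ h₃ h₄
  rw [mem_edge]
  omega

lemma exists_edge_of_forall_vCovers {b t x : ℤ} (hbt : b < t)
    (h : ∀ y, b ≤ y → y < t → ∃ i, P.VCovers i x y) :
    ∃ i, Set.Icc (x, b) (x, t) ⊆ P.edge i := by
  obtain ⟨i, hi⟩ := h b le_rfl hbt
  have hall := forall_of_exists_of_step (p := fun y => P.VCovers i x y) (l := b) (r := t)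
    (fun y h₁ h₂ => by
      obtain ⟨j, hj⟩ := h (y - 1) (by omega) (by omega)
      obtain ⟨k, hk⟩ := h y (by omega) (by omega)
      have hjk : j = k := P.vertical_edge_unique hj.1 hk.1
        (by simpa only [sub_add_cancel] using hj.top_mem) hk.bottom_mem
      subst hjk
      constructor
      · intro hi'
        rwa [P.subsingleton_vCovers _ _ hi' hj]
      · intro hi'
        rwa [P.subsingleton_vCovers _ _ hi' hk]) ⟨b, le_rfl, hbt, hi⟩
  refine ⟨i, fun c hc => ?_⟩
  obtain ⟨⟨h₁, h₂⟩, h₃, h₄⟩ := hc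
  have h₅ := hall (t - 1) (by omega) (by omega)
  simp only [VCovers] at hi h₅
  dsimp only at h₁ h₂ h₃ h₄
  rw [mem_edge]
  omega

lemma hCovers_of_subset_edge {i : Fin n} {l r y : ℤ} (h : Set.Icc (l, y) (r, y) ⊆ P.edge i)
    {x : ℤ} (hl : l ≤ x) (hr : x < r) : P.HCovers i x y := by
  have h₁ := P.mem_edge.1 (@h (l, y) (by constructor <;> constructor <;> dsimp only <;> omega))
  have h₂ := P.mem_edge.1 (@h (r, y) (by constructor <;> constructor <;> dsimp only <;> omega))
  have h₃ := P.axis i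
  simp only [HCovers] at *
  omega

lemma vCovers_of_subset_edge {i : Fin n} {b t x : ℤ} (h : Set.Icc (x, b) (x, t) ⊆ P.edge i)
    {y : ℤ} (hb : b ≤ y) (ht : y < t) : P.VCovers i x y := by
  have h₁ := P.mem_edge.1 (@h (x, b) (by constructor <;> constructor <;> dsimp only <;> omega))
  have h₂ := P.mem_edge.1 (@h (x, t) (by constructor <;> constructor <;> dsimp only <;> omega))
  have h₃ := P.axis i
  simp only [VCovers] at *
  omega

/-- This translates between strips described by blocks, for which the counting is done, and strips
described by edges, as the algorithm uses them. -/
lemma hStrip_iff {Y : Rect} : HStrip P.region Y ↔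
    P.Inside Y ∧ ∃ e₁ e₂, Y.topSide ⊆ P.edge e₁ ∧ Y.bottomSide ⊆ P.edge e₂ := by
  constructor
  · intro hY
    have hw := hY.width_pos
    have hh := hY.height_pos
    refine ⟨⟨sub_pos.2 hw, sub_pos.2 hh, hY.subset⟩, ?_⟩
    obtain ⟨e₁, he₁⟩ := exists_edge_of_forall_hCovers (P := P) (y := Y.top) hw (fun x h₁ h₂ => by
      rw [← region_horizontal_jump]
      have h₃ := hY.above x h₁ h₂
      have h₄ := @hY.subset (x, Y.top - 1) (by simp only [Rect.mem_blocks]; omega)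
      tauto)
    obtain ⟨e₂, he₂⟩ := exists_edge_of_forall_hCovers (P := P) (y := Y.bottom) hw
      (fun x h₁ h₂ => by
        rw [← region_horizontal_jump]
        have h₃ := hY.below x h₁ h₂
        have h₄ := @hY.subset (x, Y.bottom) (by simp only [Rect.mem_blocks]; omega)
        tauto)
    exact ⟨e₁, e₂, he₁, he₂⟩
  · rintro ⟨⟨hw, hh, hs⟩, e₁, e₂, he₁, he₂⟩
    simp only [Rect.width, Rect.height] at hw hh
    refine ⟨by omega, by omega, hs, fun x h₁ h₂ => ?_, fun x h₁ h₂ => ?_⟩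
    · have h₃ := (P.region_horizontal_jump x Y.top).2 ⟨_, hCovers_of_subset_edge he₁ h₁ h₂⟩
      have h₄ := @hs (x, Y.top - 1) (by simp only [Rect.mem_blocks]; omega)
      tauto
    · have h₃ := (P.region_horizontal_jump x Y.bottom).2 ⟨_, hCovers_of_subset_edge he₂ h₁ h₂⟩
      have h₄ := @hs (x, Y.bottom) (by simp only [Rect.mem_blocks]; omega)
      tauto

lemma vStrip_iff {Y : Rect} : HStrip (Prod.swap ⁻¹' P.region) Y.swap ↔
    P.Inside Y ∧ ∃ e₁ e₂, Y.leftSide ⊆ P.edge e₁ ∧ Y.rightSide ⊆ P.edge e₂ := by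
  constructor
  · intro hY
    have hh : Y.bottom < Y.top := hY.width_pos
    have hw : Y.left < Y.right := hY.height_pos
    have hs : Y.blocks ⊆ P.region := fun c hc =>
      @hY.subset c.swap (by simpa [Rect.mem_blocks_swap] using hc)
    refine ⟨⟨sub_pos.2 hw, sub_pos.2 hh, hs⟩, ?_⟩
    obtain ⟨e₁, he₁⟩ := exists_edge_of_forall_vCovers (P := P) (x := Y.left) hh (fun y h₁ h₂ => by
      rw [← region_vertical_jump]
      have h₃ : (Y.left - 1, y) ∉ P.region := hY.below y h₁ h₂
      have h₄ := @hs (Y.left, y) (by simp only [Rect.mem_blocks]; omega)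
      tauto)
    obtain ⟨e₂, he₂⟩ := exists_edge_of_forall_vCovers (P := P) (x := Y.right) hh
      (fun y h₁ h₂ => by
        rw [← region_vertical_jump]
        have h₃ : (Y.right, y) ∉ P.region := hY.above y h₁ h₂
        have h₄ := @hs (Y.right - 1, y) (by simp only [Rect.mem_blocks]; omega)
        tauto)
    exact ⟨e₁, e₂, he₁, he₂⟩
  · rintro ⟨⟨hw, hh, hs⟩, e₁, e₂, he₁, he₂⟩
    simp only [Rect.width, Rect.height] at hw hh
    refine ⟨sub_pos.1 hh, sub_pos.1 hw, fun c hc => hs (Rect.mem_blocks_swap.1 hc),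
      fun y h₁ h₂ => ?_, fun y h₁ h₂ => ?_⟩
    · change (Y.right, y) ∉ P.region
      change Y.bottom ≤ y at h₁
      change y < Y.top at h₂
      have h₃ := (P.region_vertical_jump Y.right y).2 ⟨_, vCovers_of_subset_edge he₂ h₁ h₂⟩
      have h₄ := @hs (Y.right - 1, y) (by simp only [Rect.mem_blocks]; omega)
      tauto
    · change (Y.left - 1, y) ∉ P.region
      change Y.bottom ≤ y at h₁
      change y < Y.top at h₂
      have h₃ := (P.region_vertical_jump Y.left y).2 ⟨_, vCovers_of_subset_edge he₁ h₁ h₂⟩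
      have h₄ := @hs (Y.left, y) (by simp only [Rect.mem_blocks]; omega)
      tauto

end OrthoPolygon

/-- A maximal horizontal strip that is longer than high. -/
def HLong (Q : Set (ℤ × ℤ)) (Y : Rect) : Prop := HMax Q Y ∧ Y.height < Y.width

namespace OrthoPolygon

variable {n : ℕ} [NeZero n] {P : OrthoPolygon n}

lemma Inside.exists_mem {Y : Rect} (h : P.Inside Y) : (Y.left, Y.bottom) ∈ Y.blocks := by
  obtain ⟨h₁, h₂, -⟩ := h
  simp only [Rect.width, Rect.height] at h₁ h₂
  simp only [Rect.mem_blocks]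
  omega

lemma Inside.blocks_subset_iff {Y Z : Rect} (h : P.Inside Y) : Y.blocks ⊆ Z.blocks ↔
    Z.left ≤ Y.left ∧ Y.right ≤ Z.right ∧ Z.bottom ≤ Y.bottom ∧ Y.top ≤ Z.top :=
  Rect.blocks_subset_iff (sub_pos.1 h.1) (sub_pos.1 h.2.1)

/-- A larger `HStrip` overlaps `Y` and so has the same height; hence it is still longer than high
and competes with `Y` in `IsStrip`. -/
lemma IsStrip.hLong {e₁ e₂ : Fin n} {Y : Rect} (h : P.IsStrip e₁ e₂ Y)
    (ht : Y.topSide ⊆ P.edge e₁) (hb : Y.bottomSide ⊆ P.edge e₂) (hlt : Y.height < Y.width) :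
    HLong P.region Y := by
  have hY : HStrip P.region Y := hStrip_iff.2 ⟨h.1.1, e₁, e₂, ht, hb⟩
  refine ⟨⟨hY, fun Y' hY' hs => ?_⟩, hlt⟩
  obtain ⟨hin, f₁, f₂, hf₁, hf₂⟩ := hStrip_iff.1 hY'
  refine h.2 f₁ f₂ Y' ⟨hin, .inl ⟨?_, hf₁, hf₂⟩⟩ hs
  have h₁ := h.1.1.blocks_subset_iff.1 hs
  have h₂ := hY.bottom_eq_top_eq hY' h.1.1.exists_mem (hs h.1.1.exists_mem)
  simp only [Rect.width, Rect.height] at *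
  omega

lemma IsStrip.vLong {e₁ e₂ : Fin n} {Y : Rect} (h : P.IsStrip e₁ e₂ Y)
    (ht : Y.leftSide ⊆ P.edge e₁) (hb : Y.rightSide ⊆ P.edge e₂) (hlt : Y.width < Y.height) :
    HLong (Prod.swap ⁻¹' P.region) Y.swap := by
  have hY : HStrip (Prod.swap ⁻¹' P.region) Y.swap := vStrip_iff.2 ⟨h.1.1, e₁, e₂, ht, hb⟩
  refine ⟨⟨hY, fun Y' hY' hs => ?_⟩, hlt⟩
  rw [← Y'.swap_swap] at hY' hs
  obtain ⟨hin, f₁, f₂, hf₁, hf₂⟩ := vStrip_iff.1 hY'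
  have hs' := Rect.swap_subset.1 hs
  rw [← h.2 f₁ f₂ Y'.swap ⟨hin, .inr ⟨?_, hf₁, hf₂⟩⟩ hs', Rect.swap_swap]
  have h₁ := h.1.1.blocks_subset_iff.1 hs'
  have h₂ := hY.bottom_eq_top_eq hY' (b := (Y.bottom, Y.left))
    (Rect.mem_blocks_swap.2 h.1.1.exists_mem) (hs (Rect.mem_blocks_swap.2 h.1.1.exists_mem))
  simp only [Rect.width, Rect.height, Rect.swap] at *
  omega

/-- Maximality in `IsStrip` is among both orientations, but a vertical strip cannot overlap a
horizontal one. -/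
lemma isStrip_of_hLong {e₁ e₂ : Fin n} {Y : Rect} (h : HLong P.region Y)
    (ht : Y.topSide ⊆ P.edge e₁) (hb : Y.bottomSide ⊆ P.edge e₂) : P.IsStrip e₁ e₂ Y := by
  have hin := (hStrip_iff.1 h.1.1).1
  refine ⟨⟨hin, .inl ⟨h.2, ht, hb⟩⟩, ?_⟩
  rintro f₁ f₂ Y' ⟨hin', ⟨-, hf₁, hf₂⟩ | ⟨hlt, hf₁, hf₂⟩⟩ hs
  · exact h.1.2 Y' (hStrip_iff.2 ⟨hin', f₁, f₂, hf₁, hf₂⟩) hs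
  · exact (HStrip.not_mem_of_swap h.1.1 h.2 (vStrip_iff.2 ⟨hin', f₁, f₂, hf₁, hf₂⟩) hlt
      hin.exists_mem (hs hin.exists_mem)).elim

lemma isStrip_of_vLong {e₁ e₂ : Fin n} {Y : Rect} (h : HLong (Prod.swap ⁻¹' P.region) Y.swap)
    (ht : Y.leftSide ⊆ P.edge e₁) (hb : Y.rightSide ⊆ P.edge e₂) : P.IsStrip e₁ e₂ Y := by
  have hin := (vStrip_iff.1 h.1.1).1
  refine ⟨⟨hin, .inr ⟨h.2, ht, hb⟩⟩, ?_⟩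
  rintro f₁ f₂ Y' ⟨hin', ⟨hlt, hf₁, hf₂⟩ | ⟨-, hf₁, hf₂⟩⟩ hs
  · exact (HStrip.not_mem_of_swap (hStrip_iff.2 ⟨hin', f₁, f₂, hf₁, hf₂⟩) hlt h.1.1 h.2
      (hs hin.exists_mem) hin.exists_mem).elim
  · exact Rect.swap_injective (h.1.2 Y'.swap (vStrip_iff.2 ⟨hin', f₁, f₂, hf₁, hf₂⟩)
      (Rect.swap_subset.2 hs))

end OrthoPolygon

/-! ### Rec-packs generated in a strip -/

/-- `S` has the height of `Y`, lies at the same level, and meets `Y` at least in a side. -/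
def HTouch (S Y : Rect) : Prop :=
  S.bottom = Y.bottom ∧ S.top = Y.top ∧ Y.left ≤ S.right ∧ S.left ≤ Y.right

/-- The parts of `T` in the strip `Y` do not get in the way of rec-packs with seed `S`, except
near the ends of the strip. -/
def HClear (S Y T : Rect) : Prop :=
  (T.right ≤ S.right ∧ T.right ≤ Y.left + Y.height) ∨
    (S.left ≤ T.left ∧ Y.right - Y.height ≤ T.left)

/-- The rectangle that consists of `η` copies of the square `S`, put next to `S` in direction
`δ`. -/
def Rect.pack (S : Rect) : Dir → ℕ → Rect
  | .left, η => ⟨S.left - η * S.width, S.left, S.bottom, S.top⟩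
  | .right, η => ⟨S.right, S.right + η * S.width, S.bottom, S.top⟩
  | .up, η => ⟨S.left, S.right, S.top, S.top + η * S.width⟩
  | .down, η => ⟨S.left, S.right, S.bottom - η * S.width, S.bottom⟩

lemma Rect.pack_mono {S : Rect} (hS : 0 < S.width) (δ : Dir) {η η' : ℕ} (h : η ≤ η') :
    (S.pack δ η).blocks ⊆ (S.pack δ η').blocks := by
  have : (η : ℤ) * S.width ≤ η' * S.width :=
    mul_le_mul_of_nonneg_right (by exact_mod_cast h) hS.le
  intro b hb
  cases δ <;> simp only [Rect.pack, Rect.mem_blocks] at hb ⊢ <;> omega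

lemma exists_nat_mul_le_lt {d z : ℤ} (hd : 0 < d) (hz : 0 ≤ z) :
    ∃ q : ℕ, (q : ℤ) * d ≤ z ∧ z < ((q + 1 : ℕ) : ℤ) * d := by
  refine ⟨(z / d).toNat, ?_⟩
  push_cast
  rw [Int.toNat_of_nonneg (Int.ediv_nonneg hz hd.le)]
  exact ⟨Int.ediv_mul_le z hd.ne', Int.lt_ediv_add_one_mul_self z hd⟩

namespace OrthoPolygon

variable {n : ℕ} [NeZero n] {P : OrthoPolygon n} {𝓡 : Set Rect} {S R Y : Rect} {δ : Dir}
  {η : ℕ}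

/-- Seed, direction and strength determine the rec-pack; hence each direction generates at most one.
-/
lemma eq_pack (hS : P.IsValidSquare S) (hR : P.IsRecPack S.width η R) (hab : S.Abuts R δ) :
    R = S.pack δ η := by
  obtain ⟨⟨hw, hh, -⟩, hsq⟩ := hS
  obtain ⟨-, -, hdim⟩ := hR
  -- If the side of `R` that abuts on `S` is the one of length `η * S.width`, then it equals
  -- `S.width`, and the two orientations of a rec-pack agree.
  have h₁ : S.width = η * S.width → (η : ℤ) * S.width = S.width := Eq.symm
  cases δ <;> simp only [Rect.Abuts] at hab <;> simp only [Rect.pack, Rect.ext_iff] <;>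
    simp only [Rect.width, Rect.height] at * <;> generalize (η : ℤ) * (S.right - S.left) = m at * <;>
    omega

/-- Every rec-pack that may be placed is contained in the one that is generated. -/
lemma exists_generated_of_canPlace (hS : P.IsValidSquare S) (h : P.CanPlace 𝓡 S δ η R) :
    ∃ R' ∈ P.generated 𝓡 S δ, R.blocks ⊆ R'.blocks := by
  obtain ⟨M, hM⟩ := P.region_bounded
  have heq : ∀ η R, P.CanPlace 𝓡 S δ η R → R = S.pack δ η := by
    rintro η R ⟨-, -, -, -, -, -, -, hR, hab, -⟩
    exact eq_pack hS hR hab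
  have hd : 0 < S.width := hS.1.1
  -- Strengths are bounded because the region is, so a largest one exists.
  have hbd : ∀ η R, P.CanPlace 𝓡 S δ η R → (η : ℤ) ≤ 2 * M := by
    rintro η R ⟨-, -, -, -, -, -, -, ⟨h₁, hin, hdim⟩, -⟩
    have h₂ := hM _ (hin.2.2 hin.exists_mem)
    have h₃ := hM (R.right - 1, R.top - 1) (hin.2.2 (by
      have := hin.1
      have := hin.2.1
      simp only [Rect.mem_blocks, Rect.width, Rect.height] at *
      omega))
    have h₄ : (η : ℤ) ≤ η * S.width := le_mul_of_one_le_right (by positivity) hd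
    simp only [Rect.width, Rect.height] at *
    omega
  obtain ⟨z, ⟨η₀, rfl, R₀, h₀⟩, hmax⟩ := Int.exists_greatest_of_bdd
    (P := fun z => ∃ η : ℕ, (η : ℤ) = z ∧ ∃ R, P.CanPlace 𝓡 S δ η R)
    ⟨2 * M, by rintro _ ⟨η, rfl, R, hR⟩; exact hbd η R hR⟩ ⟨η, η, rfl, R, h⟩
  refine ⟨R₀, ⟨η₀, h₀, fun η' R' h' => ?_⟩, ?_⟩
  · exact_mod_cast hmax _ ⟨η', rfl, R', h'⟩
  · rw [heq _ _ h, heq _ _ h₀]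
    exact Rect.pack_mono hd δ (by exact_mod_cast hmax _ ⟨η, rfl, R, h⟩)

lemma generated_subsingleton (hS : P.IsValidSquare S) : (P.generated 𝓡 S δ).Subsingleton := by
  rintro R ⟨η, h, hm⟩ R' ⟨η', h', hm'⟩
  obtain rfl : η = η' := le_antisymm (hm' _ _ h) (hm _ _ h')
  obtain ⟨-, -, -, -, -, -, -, hR, hab, -⟩ := h
  obtain ⟨-, -, -, -, -, -, -, hR', hab', -⟩ := h'
  rw [eq_pack hS hR hab, eq_pack hS hR' hab']

lemma snd_eq_of_horizontal {e : Fin n} {l r y : ℤ} (hlr : l < r)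
    (he : Set.Icc (l, y) (r, y) ⊆ P.edge e) {c : ℤ × ℤ} (hc : c ∈ P.edge e) : c.2 = y := by
  have h₁ := hCovers_of_subset_edge he le_rfl hlr
  rw [mem_edge] at hc
  simp only [HCovers] at h₁
  omega

lemma fst_eq_of_vertical {e : Fin n} {b t x : ℤ} (hbt : b < t)
    (he : Set.Icc (x, b) (x, t) ⊆ P.edge e) {c : ℤ × ℤ} (hc : c ∈ P.edge e) : c.1 = x := by
  have h₁ := vCovers_of_subset_edge he le_rfl hbt
  rw [mem_edge] at hc
  simp only [VCovers] at h₁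
  omega

/-- A rec-pack that may be placed lies in a strip that the seed touches. -/
lemma CanPlace.exists_strip (hS : P.IsValidSquare S) (h : P.CanPlace 𝓡 S δ η R) :
    (∃ Y, HLong P.region Y ∧ HTouch S Y ∧ R.blocks ⊆ Y.blocks) ∨
      ∃ Y, HLong (Prod.swap ⁻¹' P.region) Y ∧ HTouch S.swap Y ∧ R.swap.blocks ⊆ Y.blocks := by
  obtain ⟨e₁, e₂, Y, hc₁, hc₂, hY, -, ⟨-, hin, -⟩, hab, hs, -⟩ := h
  have hRY := hin.blocks_subset_iff.1 hs
  have hRw := hin.1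
  have hRh := hin.2.1
  have hYw := hY.1.1.1
  have hYh := hY.1.1.2.1
  have hSw := hS.1.1
  have hSh := hS.1.2.1
  simp only [Rect.width, Rect.height] at hRw hRh hYw hYh hSw hSh
  rcases hY.1.2 with ⟨hlt, he₁, he₂⟩ | ⟨hlt, he₁, he₂⟩
  · left
    refine ⟨Y, hY.hLong he₁ he₂ hlt, ?_, hs⟩
    -- The front corners lie at the heights of the two long sides of `Y`. In the directions up and
    -- down they have the same height, so `δ` is left or right.
    have h₁ := snd_eq_of_horizontal (sub_pos.1 hYw) he₁ hc₁
    have h₂ := snd_eq_of_horizontal (sub_pos.1 hYw) he₂ hc₂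
    cases δ <;> simp only [Rect.frontCorners, Rect.Abuts, HTouch] at * <;> omega
  · right
    refine ⟨Y.swap, hY.vLong he₁ he₂ hlt, ?_, Rect.swap_subset.2 hs⟩
    have h₁ := fst_eq_of_vertical (sub_pos.1 hYh) he₁ hc₁
    have h₂ := fst_eq_of_vertical (sub_pos.1 hYh) he₂ hc₂
    cases δ <;> simp only [Rect.frontCorners, Rect.Abuts, HTouch, Rect.swap] at * <;> omega

/-- A seed that touches a horizontal strip generates rec-packs which, together with the seed,
cover the middle part of the strip. -/
lemma exists_mem_of_hMid (hS : P.IsValidSquare S) (hY : HLong P.region Y) (ht : HTouch S Y)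
    (hfree : ∀ T ∈ 𝓡, ∀ b ∈ T.blocks, b ∈ Y.blocks → HClear S Y T) {b : ℤ × ℤ}
    (hb : b ∈ Y.blocks) (hmid : HMid Y b.1) :
    ∃ R ∈ insert S 𝓡 ∪ ⋃ δ, P.generated (insert S 𝓡) S δ, b ∈ R.blocks := by
  obtain ⟨⟨hw, hh, -⟩, hsq⟩ := id hS
  obtain ⟨hin, e₁, e₂, he₁, he₂⟩ := hStrip_iff.1 hY.1.1
  have hstrip := isStrip_of_hLong hY he₁ he₂
  obtain ⟨d, hd⟩ : ∃ d, d = S.width := ⟨_, rfl⟩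
  have hd' : S.height = d := by omega
  have hYd : Y.height = d := by
    rw [← hd']
    simp only [Rect.height, HTouch] at *
    omega
  have hdh : Y.top - Y.bottom = d := hYd
  rw [← hd] at hw
  simp only [HMid, HTouch, hYd, HClear] at *
  have hdw : S.right - S.left = d := hd.symm
  have hb' := hb
  rw [Rect.mem_blocks] at hb'
  rcases lt_or_ge b.1 S.left with hl | hl
  · obtain ⟨q, hq₁, hq₂⟩ := exists_nat_mul_le_lt (z := S.left - 1 - b.1) hw (by omega)
    have hq₃ : ((q + 1 : ℕ) : ℤ) * d = q * d + d := by push_cast; ring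
    have hpack : S.pack .left (q + 1) =
        ⟨S.left - ((q + 1 : ℕ) : ℤ) * d, S.left, S.bottom, S.top⟩ := by rw [Rect.pack, hd]
    generalize hm : ((q + 1 : ℕ) : ℤ) * d = m at hpack hq₂ hq₃
    have hsub : (S.pack .left (q + 1)).blocks ⊆ Y.blocks := by
      rw [hpack]
      intro c hc
      simp only [Rect.mem_blocks] at hc ⊢
      omega
    have hcan : P.CanPlace (insert S 𝓡) S .left (q + 1) (S.pack .left (q + 1)) := by
      refine ⟨e₁, e₂, Y, he₁ ?_, he₂ ?_, hstrip, ?_, ⟨by omega, ⟨?_, ?_, ?_⟩, .inr ⟨?_, ?_⟩⟩, ?_,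
        hsub, ?_⟩
      · simp only [Rect.frontCorners, Rect.topSide, Set.mem_Icc, Prod.mk_le_mk]; omega
      · simp only [Rect.frontCorners, Rect.bottomSide, Set.mem_Icc, Prod.mk_le_mk]; omega
      · rw [← hd]; simp only [Rect.reach]; omega
      · rw [hpack]; simp only [Rect.width]; omega
      · rw [hpack]; simp only [Rect.height]; omega
      · exact hsub.trans hin.2.2
      · rw [hpack, ← hd, hm]; simp only [Rect.width]; omega
      · rw [hpack, ← hd]; simp only [Rect.height]; omega
      · rw [hpack]; simp only [Rect.Abuts, and_self]
      · rintro T (rfl | hT) ⟨c, hc, hcT⟩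
        · rw [hpack] at hc
          simp only [Rect.mem_blocks] at hc hcT
          omega
        · have := hfree T hT c hcT (hsub hc)
          rw [hpack] at hc
          simp only [Rect.mem_blocks] at hc hcT
          omega
    obtain ⟨R', hR', hsub'⟩ := exists_generated_of_canPlace hS hcan
    refine ⟨R', .inr (Set.mem_iUnion.2 ⟨_, hR'⟩), hsub' ?_⟩
    rw [hpack]
    simp only [Rect.mem_blocks]
    omega
  rcases lt_or_ge b.1 S.right with hr | hr
  · refine ⟨S, .inl (.inl rfl), ?_⟩
    simp only [Rect.mem_blocks]
    omega
  · obtain ⟨q, hq₁, hq₂⟩ := exists_nat_mul_le_lt (z := b.1 - S.right) hw (by omega)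
    have hq₃ : ((q + 1 : ℕ) : ℤ) * d = q * d + d := by push_cast; ring
    have hpack : S.pack .right (q + 1) =
        ⟨S.right, S.right + ((q + 1 : ℕ) : ℤ) * d, S.bottom, S.top⟩ := by rw [Rect.pack, hd]
    generalize hm : ((q + 1 : ℕ) : ℤ) * d = m at hpack hq₂ hq₃
    have hsub : (S.pack .right (q + 1)).blocks ⊆ Y.blocks := by
      rw [hpack]
      intro c hc
      simp only [Rect.mem_blocks] at hc ⊢
      omega
    have hcan : P.CanPlace (insert S 𝓡) S .right (q + 1) (S.pack .right (q + 1)) := by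
      refine ⟨e₁, e₂, Y, he₁ ?_, he₂ ?_, hstrip, ?_, ⟨by omega, ⟨?_, ?_, ?_⟩, .inr ⟨?_, ?_⟩⟩, ?_,
        hsub, ?_⟩
      · simp only [Rect.frontCorners, Rect.topSide, Set.mem_Icc, Prod.mk_le_mk]; omega
      · simp only [Rect.frontCorners, Rect.bottomSide, Set.mem_Icc, Prod.mk_le_mk]; omega
      · rw [← hd]; simp only [Rect.reach]; omega
      · rw [hpack]; simp only [Rect.width]; omega
      · rw [hpack]; simp only [Rect.height]; omega
      · exact hsub.trans hin.2.2
      · rw [hpack, ← hd, hm]; simp only [Rect.width]; omega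
      · rw [hpack, ← hd]; simp only [Rect.height]; omega
      · rw [hpack]; simp only [Rect.Abuts, and_self]
      · rintro T (rfl | hT) ⟨c, hc, hcT⟩
        · rw [hpack] at hc
          simp only [Rect.mem_blocks] at hc hcT
          omega
        · have := hfree T hT c hcT (hsub hc)
          rw [hpack] at hc
          simp only [Rect.mem_blocks] at hc hcT
          omega
    obtain ⟨R', hR', hsub'⟩ := exists_generated_of_canPlace hS hcan
    refine ⟨R', .inr (Set.mem_iUnion.2 ⟨_, hR'⟩), hsub' ?_⟩
    rw [hpack]
    simp only [Rect.mem_blocks]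
    omega

/-- A seed that touches a vertical strip generates rec-packs which, together with the seed,
cover the middle part of the strip. -/
lemma exists_mem_of_vMid (hS : P.IsValidSquare S)
    (hY : HLong (Prod.swap ⁻¹' P.region) Y.swap) (ht : HTouch S.swap Y.swap)
    (hfree : ∀ T ∈ 𝓡, ∀ b ∈ T.blocks, b ∈ Y.blocks → HClear S.swap Y.swap T.swap) {b : ℤ × ℤ}
    (hb : b ∈ Y.blocks) (hmid : HMid Y.swap b.2) :
    ∃ R ∈ insert S 𝓡 ∪ ⋃ δ, P.generated (insert S 𝓡) S δ, b ∈ R.blocks := by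
  obtain ⟨⟨hw, hh, -⟩, hsq⟩ := id hS
  obtain ⟨hin, e₁, e₂, he₁, he₂⟩ := vStrip_iff.1 hY.1.1
  have hstrip := isStrip_of_vLong hY he₁ he₂
  obtain ⟨d, hd⟩ : ∃ d, d = S.width := ⟨_, rfl⟩
  have hd' : S.height = d := by omega
  have hYd : Y.swap.height = d := by
    rw [hd]
    simp only [Rect.height, HTouch, Rect.swap, Rect.width] at *
    omega
  have hdh : Y.right - Y.left = d := hYd
  rw [← hd] at hw
  simp only [HMid, HTouch, hYd, HClear] at *
  simp only [Rect.swap] at ht hfree hmid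
  have hdw : S.right - S.left = d := hd.symm
  have hdt : S.top - S.bottom = d := hd'
  have hb' := hb
  rw [Rect.mem_blocks] at hb'
  rcases lt_or_ge b.2 S.bottom with hl | hl
  · obtain ⟨q, hq₁, hq₂⟩ := exists_nat_mul_le_lt (z := S.bottom - 1 - b.2) hw (by omega)
    have hq₃ : ((q + 1 : ℕ) : ℤ) * d = q * d + d := by push_cast; ring
    have hpack : S.pack .down (q + 1) =
        ⟨S.left, S.right, S.bottom - ((q + 1 : ℕ) : ℤ) * d, S.bottom⟩ := by rw [Rect.pack, hd]
    generalize hm : ((q + 1 : ℕ) : ℤ) * d = m at hpack hq₂ hq₃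
    have hsub : (S.pack .down (q + 1)).blocks ⊆ Y.blocks := by
      rw [hpack]
      intro c hc
      simp only [Rect.mem_blocks] at hc ⊢
      omega
    have hcan : P.CanPlace (insert S 𝓡) S .down (q + 1) (S.pack .down (q + 1)) := by
      refine ⟨e₁, e₂, Y, he₁ ?_, he₂ ?_, hstrip, ?_, ⟨by omega, ⟨?_, ?_, ?_⟩, .inl ⟨?_, ?_⟩⟩, ?_,
        hsub, ?_⟩
      · simp only [Rect.frontCorners, Rect.leftSide, Set.mem_Icc, Prod.mk_le_mk]; omega
      · simp only [Rect.frontCorners, Rect.rightSide, Set.mem_Icc, Prod.mk_le_mk]; omega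
      · rw [← hd]; simp only [Rect.reach]; omega
      · rw [hpack]; simp only [Rect.width]; omega
      · rw [hpack]; simp only [Rect.height]; omega
      · exact hsub.trans hin.2.2
      · rw [hpack, ← hd]; simp only [Rect.width]; omega
      · rw [hpack, ← hd, hm]; simp only [Rect.height]; omega
      · rw [hpack]; simp only [Rect.Abuts, and_self]
      · rintro T (rfl | hT) ⟨c, hc, hcT⟩
        · rw [hpack] at hc
          simp only [Rect.mem_blocks] at hc hcT
          omega
        · have := hfree T hT c hcT (hsub hc)
          rw [hpack] at hc
          simp only [Rect.mem_blocks] at hc hcT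
          omega
    obtain ⟨R', hR', hsub'⟩ := exists_generated_of_canPlace hS hcan
    refine ⟨R', .inr (Set.mem_iUnion.2 ⟨_, hR'⟩), hsub' ?_⟩
    rw [hpack]
    simp only [Rect.mem_blocks]
    omega
  rcases lt_or_ge b.2 S.top with hr | hr
  · refine ⟨S, .inl (.inl rfl), ?_⟩
    simp only [Rect.mem_blocks]
    omega
  · obtain ⟨q, hq₁, hq₂⟩ := exists_nat_mul_le_lt (z := b.2 - S.top) hw (by omega)
    have hq₃ : ((q + 1 : ℕ) : ℤ) * d = q * d + d := by push_cast; ring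
    have hpack : S.pack .up (q + 1) =
        ⟨S.left, S.right, S.top, S.top + ((q + 1 : ℕ) : ℤ) * d⟩ := by rw [Rect.pack, hd]
    generalize hm : ((q + 1 : ℕ) : ℤ) * d = m at hpack hq₂ hq₃
    have hsub : (S.pack .up (q + 1)).blocks ⊆ Y.blocks := by
      rw [hpack]
      intro c hc
      simp only [Rect.mem_blocks] at hc ⊢
      omega
    have hcan : P.CanPlace (insert S 𝓡) S .up (q + 1) (S.pack .up (q + 1)) := by
      refine ⟨e₁, e₂, Y, he₁ ?_, he₂ ?_, hstrip, ?_, ⟨by omega, ⟨?_, ?_, ?_⟩, .inl ⟨?_, ?_⟩⟩, ?_,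
        hsub, ?_⟩
      · simp only [Rect.frontCorners, Rect.leftSide, Set.mem_Icc, Prod.mk_le_mk]; omega
      · simp only [Rect.frontCorners, Rect.rightSide, Set.mem_Icc, Prod.mk_le_mk]; omega
      · rw [← hd]; simp only [Rect.reach]; omega
      · rw [hpack]; simp only [Rect.width]; omega
      · rw [hpack]; simp only [Rect.height]; omega
      · exact hsub.trans hin.2.2
      · rw [hpack, ← hd]; simp only [Rect.width]; omega
      · rw [hpack, ← hd, hm]; simp only [Rect.height]; omega
      · rw [hpack]; simp only [Rect.Abuts, and_self]
      · rintro T (rfl | hT) ⟨c, hc, hcT⟩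
        · rw [hpack] at hc
          simp only [Rect.mem_blocks] at hc hcT
          omega
        · have := hfree T hT c hcT (hsub hc)
          rw [hpack] at hc
          simp only [Rect.mem_blocks] at hc hcT
          omega
    obtain ⟨R', hR', hsub'⟩ := exists_generated_of_canPlace hS hcan
    refine ⟨R', .inr (Set.mem_iUnion.2 ⟨_, hR'⟩), hsub' ?_⟩
    rw [hpack]
    simp only [Rect.mem_blocks]
    omega

end OrthoPolygon

/-- A maximal square `T` that overlaps a strip touched by the square `S`, without touching it in
the same way, sticks out of the union of the strip and `S`. -/
lemma hClear_of_not_hTouch {Q : Set (ℤ × ℤ)} {S T Y : Rect} (hS : ValidIn Q S) (hT : ValidIn Q T)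
    (hmax : ∀ U, ValidIn Q U → T.blocks ⊆ U.blocks → ¬ T.width < U.width) (hY : HStrip Q Y)
    (hSY : HTouch S Y) (hTY : ¬ HTouch T Y) {b : ℤ × ℤ} (hb : b ∈ T.blocks) (hbY : b ∈ Y.blocks) :
    HClear S Y T := by
  have h₁ := hY.bottom_le_top_le hT.1.2.2 hb hbY
  obtain ⟨⟨hSw, hSh, hSs⟩, hSq⟩ := hS
  obtain ⟨⟨hTw, hTh, hTs⟩, hTq⟩ := hT
  by_contra hcl
  -- Since `T` lies in the rows of `Y` and overlaps `Y`, failing `HTouch` makes it lower than `Y`.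
  -- The larger square has the rows of `Y` and ends with `T`, unless that would take it beyond the
  -- left end of the union of `Y` and `S`. If `HClear` fails, it contains `T` and stays in the
  -- union.
  refine hmax ⟨max (T.right - Y.height) (min S.left Y.left),
    max (T.right - Y.height) (min S.left Y.left) + Y.height, Y.bottom, Y.top⟩
    ⟨⟨?_, ?_, ?_⟩, ?_⟩ ?_ ?_
  all_goals simp only [HTouch, HClear, Rect.width, Rect.height, Rect.mem_blocks] at *
  · omega
  · omega
  · rintro ⟨x, y⟩ hc
    simp only [Rect.mem_blocks] at hc
    by_cases hx : Y.left ≤ x ∧ x < Y.right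
    · exact hY.subset ⟨hx.1, hx.2, hc.2.2⟩
    · exact hSs (by simp only [Rect.mem_blocks]; omega)
  · omega
  · intro c hc
    simp only [Rect.mem_blocks] at hc ⊢
    omega
  · omega

lemma hTouch_of_subset {S Y : Rect} (hw : 0 < S.width) (hh : 0 < S.height)
    (hs : S.blocks ⊆ Y.blocks) (hb : S.bottom = Y.bottom) (ht : S.top = Y.top) : HTouch S Y := by
  have := (Rect.blocks_subset_iff (sub_pos.1 hw) (sub_pos.1 hh)).1 hs
  simp only [Rect.width, Rect.height] at hw hh
  exact ⟨hb, ht, by omega, by omega⟩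

/-! ### The invariant of a run -/

namespace OrthoPolygon

variable {n : ℕ} [NeZero n] {P : OrthoPolygon n}

/-- What a run of the algorithm maintains: `𝒮` lists the seeds chosen so far, each together with
the simplicial node it was chosen for. -/
structure RunInvariant (P : OrthoPolygon n) (𝓡 : Finset Rect) (𝒮 : Finset (Rect × (ℤ × ℤ))) :
    Prop where
  card_le : 𝓡.card ≤ 5 * 𝒮.card
  independent : IsIndependentFamily P.region 𝒮
  maximal : ∀ a ∈ 𝒮, P.IsMaximalSquare a.1
  seed_mem : ∀ a ∈ 𝒮, a.1 ∈ 𝓡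
  covered : ∀ a ∈ 𝒮, ∀ T, P.IsValidSquare T → a.2 ∈ T.blocks → ∀ b ∈ T.blocks,
    ∃ R ∈ 𝓡, b ∈ R.blocks
  pack : ∀ R ∈ 𝓡, (∃ a ∈ 𝒮, a.1 = R) ∨
    (∃ a ∈ 𝒮, ∃ Y, HLong P.region Y ∧ HTouch a.1 Y ∧ R.blocks ⊆ Y.blocks) ∨
    ∃ a ∈ 𝒮, ∃ Y, HLong (Prod.swap ⁻¹' P.region) Y ∧ HTouch a.1.swap Y ∧
      R.swap.blocks ⊆ Y.blocks
  hMid_covered : ∀ Y, HLong P.region Y → ∀ a ∈ 𝒮, HTouch a.1 Y → ∀ b ∈ Y.blocks, HMid Y b.1 →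
    ∃ R ∈ 𝓡, b ∈ R.blocks
  vMid_covered : ∀ Y : Rect, HLong (Prod.swap ⁻¹' P.region) Y.swap → ∀ a ∈ 𝒮,
    HTouch a.1.swap Y.swap → ∀ b ∈ Y.blocks, HMid Y.swap b.2 → ∃ R ∈ 𝓡, b ∈ R.blocks
  hMid_unique : HMidUnique P.region 𝒮
  vMid_unique : HMidUnique (Prod.swap ⁻¹' P.region) (𝒮.map swapPair)

lemma runInvariant_empty : P.RunInvariant ∅ ∅ where
  card_le := by simp
  independent := ⟨by simp, by simp, by simp⟩
  maximal := by simp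
  seed_mem := by simp
  covered := by simp
  pack := by simp
  hMid_covered := by simp
  vMid_covered := by simp
  hMid_unique := by simp [HMidUnique]
  vMid_unique := by simp [HMidUnique]

/-- One seed and at most one rec-pack for each of the four directions. -/
lemma card_le_of_eq_insert_union_generated {𝓡 𝓡' : Finset Rect} {S : Rect}
    (hS : P.IsValidSquare S)
    (h : (𝓡' : Set Rect) = insert S (𝓡 : Set Rect) ∪ ⋃ δ, P.generated (insert S 𝓡) S δ) :
    𝓡'.card ≤ 𝓡.card + 5 := by
  classical
  have hg : ∀ δ, ∃ F : Finset Rect, F.card ≤ 1 ∧ P.generated (insert S 𝓡) S δ = F := by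
    intro δ
    have hfin := (P.generated_subsingleton (𝓡 := insert S 𝓡) (δ := δ) hS)
    refine ⟨hfin.finite.toFinset, Finset.card_le_one.2 fun a ha b hb => ?_, by simp⟩
    exact hfin (by simpa using ha) (by simpa using hb)
  choose F hF₁ hF₂ using hg
  have hsub : 𝓡' ⊆ insert S 𝓡 ∪ (F .left ∪ (F .right ∪ (F .up ∪ F .down))) := by
    intro R hR
    have hR' : R ∈ (𝓡' : Set Rect) := hR
    rw [h] at hR'
    simp only [Finset.mem_union, Finset.mem_insert]
    rcases hR' with (rfl | hR') | hR'
    · exact .inl (.inl rfl)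
    · exact .inl (.inr hR')
    · obtain ⟨δ, hδ⟩ := Set.mem_iUnion.1 hR'
      rw [hF₂, Finset.mem_coe] at hδ
      cases δ <;> tauto
  have h₁ := Finset.card_le_card hsub
  have h₂ := Finset.card_insert_le S 𝓡
  have h₃ := Finset.card_union_le (insert S 𝓡) (F .left ∪ (F .right ∪ (F .up ∪ F .down)))
  have h₄ := Finset.card_union_le (F .left) (F .right ∪ (F .up ∪ F .down))
  have h₅ := Finset.card_union_le (F .right) (F .up ∪ F .down)
  have h₆ := Finset.card_union_le (F .up) (F .down)
  have h₇ := hF₁ .left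
  have h₈ := hF₁ .right
  have h₉ := hF₁ .up
  have h₀ := hF₁ .down
  omega

namespace RunInvariant

variable {𝓡 : Finset Rect} {𝒮 : Finset (Rect × (ℤ × ℤ))}

/-- As long as no seed touches a strip, the members of `𝓡` overlap it only near its ends. -/
lemma hClear (hI : P.RunInvariant 𝓡 𝒮) {S Y : Rect} (hS : P.IsValidSquare S)
    (hY : HLong P.region Y) (hSY : HTouch S Y) (hno : ∀ a ∈ 𝒮, ¬ HTouch a.1 Y) :
    ∀ T ∈ (𝓡 : Set Rect), ∀ b ∈ T.blocks, b ∈ Y.blocks → HClear S Y T := by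
  intro T hT b hb hbY
  rcases hI.pack T hT with ⟨a, ha, rfl⟩ | ⟨a, ha, Y', hY', ht, hs⟩ | ⟨a, ha, Y', hY', ht, hs⟩
  · exact hClear_of_not_hTouch hS (hI.maximal a ha).1 (hI.maximal a ha).2 hY.1.1 hSY (hno a ha)
      hb hbY
  · obtain rfl := hY.1.eq_of_mem hY'.1 hbY (hs hb)
    exact (hno a ha ht).elim
  · refine (HStrip.not_mem_of_swap (Y' := Y'.swap) hY.1.1 hY.2 hY'.1.1 hY'.2 hbY ?_).elim
    exact Rect.mem_blocks_swap.2 (hs (Rect.mem_blocks_swap.2 (by simpa using hb)))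

lemma vClear (hI : P.RunInvariant 𝓡 𝒮) {S Y : Rect} (hS : P.IsValidSquare S)
    (hY : HLong (Prod.swap ⁻¹' P.region) Y.swap) (hSY : HTouch S.swap Y.swap)
    (hno : ∀ a ∈ 𝒮, ¬ HTouch a.1.swap Y.swap) :
    ∀ T ∈ (𝓡 : Set Rect), ∀ b ∈ T.blocks, b ∈ Y.blocks → HClear S.swap Y.swap T.swap := by
  intro T hT b hb hbY
  have hb' : b.swap ∈ T.swap.blocks := Rect.mem_blocks_swap.2 (by simpa using hb)
  have hbY' : b.swap ∈ Y.swap.blocks := Rect.mem_blocks_swap.2 (by simpa using hbY)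
  rcases hI.pack T hT with ⟨a, ha, rfl⟩ | ⟨a, ha, Y', hY', ht, hs⟩ | ⟨a, ha, Y', hY', ht, hs⟩
  · obtain ⟨hv, hm⟩ := hI.maximal a ha
    refine hClear_of_not_hTouch (ValidIn.swap hS) (ValidIn.swap hv) (fun U hU hsub => ?_) hY.1.1
      hSY (hno a ha) hb' hbY'
    have h₁ := hm U.swap hU.of_swap (Rect.swap_subset.1 hsub)
    rwa [show a.1.swap.width = a.1.width from hv.2.symm, show U.width = U.swap.width from hU.2]
  · exact (HStrip.not_mem_of_swap hY'.1.1 hY'.2 hY.1.1 hY.2 (hs hb) hbY).elim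
  · obtain rfl := hY.1.eq_of_mem hY'.1 hbY' (hs hb')
    exact (hno a ha ht).elim

open Classical in
lemma step (hI : P.RunInvariant 𝓡 𝒮) {𝓡' : Finset Rect} (h : P.Step 𝓡 𝓡') :
    ∃ 𝒮', P.RunInvariant 𝓡' 𝒮' := by
  obtain ⟨-, S, -, ⟨hmax, p, -, hpS, hnbr⟩, h𝓡'⟩ := h
  have hS : P.IsValidSquare S := hmax.1
  have hsub : ∀ R ∈ 𝓡, R ∈ 𝓡' := by
    intro R hR
    have : R ∈ (𝓡' : Set Rect) := by
      rw [h𝓡']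
      exact .inl (.inr hR)
    exact this
  have hS𝓡' : S ∈ 𝓡' := by
    have : S ∈ (𝓡' : Set Rect) := by
      rw [h𝓡']
      exact .inl (.inl rfl)
    exact this
  have hp : ∀ R ∈ 𝓡, ((p : P.region) : ℤ × ℤ) ∉ R.blocks := p.2
  obtain ⟨q, hq⟩ : ∃ q : ℤ × ℤ, q = ((p : P.region) : ℤ × ℤ) := ⟨_, rfl⟩
  rw [← hq] at hp hpS
  have hmono : ∀ b : ℤ × ℤ, (∃ R ∈ 𝓡, b ∈ R.blocks) → ∃ R ∈ 𝓡', b ∈ R.blocks :=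
    fun b ⟨R, hR, hb⟩ => ⟨R, hsub R hR, hb⟩
  have hpnot : ¬ ∃ R ∈ 𝓡, q ∈ R.blocks := fun ⟨R, hR, hb⟩ => hp R hR hb
  have hnew : (S, q) ∉ 𝒮 := fun hmem => hp S (hI.seed_mem _ hmem) hpS
  -- Every valid square through an old witness is already covered, while the new witness `q` is not.
  have hindep : ∀ a ∈ 𝒮, ∀ T, P.IsValidSquare T → a.2 ∈ T.blocks → q ∉ T.blocks :=
    fun a ha T hT haT hqT => hpnot (hI.covered a ha T hT haT q hqT)
  refine ⟨insert (S, q) 𝒮, ?_, ⟨?_, ?_, ?_⟩, ?_, ?_, ?_, ?_, ?_, ?_, ?_, ?_⟩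
  · rw [Finset.card_insert_of_notMem hnew]
    have := card_le_of_eq_insert_union_generated hS h𝓡'
    have := hI.card_le
    omega
  · exact Finset.forall_mem_insert _ _ _ |>.2 ⟨hS, hI.independent.valid⟩
  · exact Finset.forall_mem_insert _ _ _ |>.2 ⟨hpS, hI.independent.mem⟩
  · intro a ha b hb T hT haT hbT
    rcases Finset.mem_insert.1 ha with rfl | ha <;> rcases Finset.mem_insert.1 hb with rfl | hb
    · rfl
    · exact (hindep b hb T hT hbT haT).elim
    · exact (hindep a ha T hT haT hbT).elim
    · exact hI.independent.eq a ha b hb T hT haT hbT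
  · exact Finset.forall_mem_insert _ _ _ |>.2 ⟨hmax, hI.maximal⟩
  · exact Finset.forall_mem_insert _ _ _ |>.2 ⟨hS𝓡', fun a ha => hsub _ (hI.seed_mem a ha)⟩
  · refine Finset.forall_mem_insert _ _ _ |>.2 ⟨fun T hT hqT b hb => ?_,
      fun a ha T hT haT b hb => hmono b (hI.covered a ha T hT haT b hb)⟩
    -- A still uncovered block of `T` other than `q` is a neighbour of `q` in the residual graph, so
    -- the unambiguous square covers it.
    by_cases hb𝓡 : ∃ R ∈ 𝓡, b ∈ R.blocks
    · exact hmono b hb𝓡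
    · refine ⟨S, hS𝓡', ?_⟩
      by_cases hbq : b = q
      · rwa [hbq]
      · refine hnbr ⟨⟨b, hT.1.2.2 hb⟩, fun R hR hbR => hb𝓡 ⟨R, hR, hbR⟩⟩ ⟨?_, T, hT, ?_, hb⟩
        · intro heq
          exact hbq ((congrArg Subtype.val heq).symm.trans hq.symm)
        · change ((p : P.region) : ℤ × ℤ) ∈ T.blocks
          rwa [← hq]
  · intro R hR
    have hR' : R ∈ (𝓡' : Set Rect) := hR
    rw [h𝓡'] at hR'
    rcases hR' with (rfl | hR') | hR'
    · exact .inl ⟨_, Finset.mem_insert_self _ _, rfl⟩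
    · rcases hI.pack R hR' with ⟨a, ha, h⟩ | ⟨a, ha, h⟩ | ⟨a, ha, h⟩
      · exact .inl ⟨a, Finset.mem_insert_of_mem ha, h⟩
      · exact .inr (.inl ⟨a, Finset.mem_insert_of_mem ha, h⟩)
      · exact .inr (.inr ⟨a, Finset.mem_insert_of_mem ha, h⟩)
    · obtain ⟨δ, η, hδ, -⟩ := Set.mem_iUnion.1 hR'
      rcases hδ.exists_strip hS with h | h
      · exact .inr (.inl ⟨_, Finset.mem_insert_self _ _, h⟩)
      · exact .inr (.inr ⟨_, Finset.mem_insert_self _ _, h⟩)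
  · intro Y hY a ha haY b hb hmid
    -- Only the first seed that touches `Y` has to cover the middle part; coverage is never lost
    -- afterwards.
    by_cases hold : ∃ a ∈ 𝒮, HTouch a.1 Y
    · obtain ⟨c, hc, hcY⟩ := hold
      exact hmono b (hI.hMid_covered Y hY c hc hcY b hb hmid)
    · push Not at hold
      rcases Finset.mem_insert.1 ha with rfl | ha
      · obtain ⟨R, hR, hbR⟩ :=
          exists_mem_of_hMid hS hY haY (hI.hClear hS hY haY hold) hb hmid
        rw [← h𝓡'] at hR
        exact ⟨R, hR, hbR⟩
      · exact (hold a ha haY).elim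
  · intro Y hY a ha haY b hb hmid
    by_cases hold : ∃ a ∈ 𝒮, HTouch a.1.swap Y.swap
    · obtain ⟨c, hc, hcY⟩ := hold
      exact hmono b (hI.vMid_covered Y hY c hc hcY b hb hmid)
    · push Not at hold
      rcases Finset.mem_insert.1 ha with rfl | ha
      · obtain ⟨R, hR, hbR⟩ :=
          exists_mem_of_vMid hS hY haY (hI.vClear hS hY haY hold) hb hmid
        rw [← h𝓡'] at hR
        exact ⟨R, hR, hbR⟩
      · exact (hold a ha haY).elim
  -- If an earlier seed of full height lies in `Y`, the middle part is already covered, so the new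
  -- witness cannot be in it.
  · have key : ∀ Y, HLong P.region Y → S.blocks ⊆ Y.blocks → HMid Y q.1 → ∀ a ∈ 𝒮,
        a.1.blocks ⊆ Y.blocks → a.1.bottom = Y.bottom → a.1.top = Y.top → False := by
      intro Y hY hSY hmid a ha hs hb ht
      have hv := hI.independent.valid a ha
      exact hpnot (hI.hMid_covered Y hY a ha (hTouch_of_subset hv.1.1 hv.1.2.1 hs hb ht) q
        (hSY hpS) hmid)
    intro Y hY hlt a ha b hb has hbs ha₁ ha₂ hb₁ hb₂ ham hbm
    rcases Finset.mem_insert.1 ha with rfl | ha <;> rcases Finset.mem_insert.1 hb with rfl | hb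
    · rfl
    · exact (key Y ⟨hY, hlt⟩ has ham b hb hbs hb₁ hb₂).elim
    · exact (key Y ⟨hY, hlt⟩ hbs hbm a ha has ha₁ ha₂).elim
    · exact hI.hMid_unique Y hY hlt a ha b hb has hbs ha₁ ha₂ hb₁ hb₂ ham hbm
  · have key : ∀ Y, HLong (Prod.swap ⁻¹' P.region) Y → S.swap.blocks ⊆ Y.blocks → HMid Y q.2 →
        ∀ a ∈ 𝒮, a.1.swap.blocks ⊆ Y.blocks → a.1.left = Y.bottom → a.1.right = Y.top →
        False := by
      intro Y hY hSY hmid a ha hs hb ht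
      have hv := hI.independent.valid a ha
      exact hpnot (hI.vMid_covered Y.swap hY a ha
        (hTouch_of_subset (S := a.1.swap) hv.1.2.1 hv.1.1 hs hb ht) q
        (Rect.mem_blocks_swap.2 (hSY (Rect.mem_blocks_swap.2 (by simpa using hpS)))) hmid)
    intro Y hY hlt
    simp only [Finset.mem_map]
    rintro _ ⟨a, ha, rfl⟩ _ ⟨b, hb, rfl⟩ has hbs ha₁ ha₂ hb₁ hb₂ ham hbm
    rcases Finset.mem_insert.1 ha with rfl | ha <;> rcases Finset.mem_insert.1 hb with rfl | hb
    · rfl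
    · exact (key Y ⟨hY, hlt⟩ has ham b hb hbs hb₁ hb₂).elim
    · exact (key Y ⟨hY, hlt⟩ hbs hbm a ha has ha₁ ha₂).elim
    · exact hI.vMid_unique Y hY hlt _ (Finset.mem_map_of_mem _ ha) _ (Finset.mem_map_of_mem _ hb)
        has hbs ha₁ ha₂ hb₁ hb₂ ham hbm

end RunInvariant

lemma exists_runInvariant {𝓡 : Finset Rect} (h : Relation.ReflTransGen P.Step ∅ 𝓡) :
    ∃ 𝒮, P.RunInvariant 𝓡 𝒮 := by
  induction h with
  | refl => exact ⟨∅, runInvariant_empty⟩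
  | tail _ hstep ih =>
    obtain ⟨𝒮, hI⟩ := ih
    exact hI.step hstep

end OrthoPolygon

end OPCS

theorem lemma5 :
    ∃ C : ℕ, ∀ (n : ℕ) [NeZero n] (P : OPCS.OrthoPolygon n) (𝓡 : Finset OPCS.Rect),
      P.IsFinal 𝓡 → 𝓡.card ≤ C * n ^ 2 := by
  refine ⟨160, fun n _ P 𝓡 h => ?_⟩
  obtain ⟨𝒮, hI⟩ := OPCS.OrthoPolygon.exists_runInvariant h.1
  have h₁ := hI.independent.card_le P.hasVertices (fun a ha => (hI.maximal a ha).2)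
    hI.hMid_unique hI.vMid_unique
  have h₂ : P.vertices.card ^ 2 ≤ n ^ 2 := Nat.pow_le_pow_left P.card_vertices_le 2
  have h₃ := hI.card_le
  omega
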